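/- Let $k$ be a commutative ring with $1$, let $X$ be a set and let $\sigma:X\times X\to X\times X$ be a bijection satisfying the Yang–Baxter equation $(\mathrm{Id}\times\sigma)(\sigma\times\mathrm{Id})(\mathrm{Id}\times\sigma)=(\sigma\times\mathrm{Id})(\mathrm{Id}\times\sigma)(\sigma\times\mathrm{Id})$. Let $A=k\langle X\rangle/(xy=zt:\sigma(x,y)=(z,t))$, and let $B=B(X,\sigma)$ be the $k$-algebra generated by symbols $x,x',e_x$ $(x\in X)$ with the relations $xy=zt$, $xy'=z't$, $x'y'=z't'$, $xe_y=e_zt$, $e_xy'=z'e_t$ whenever $\sigma(x,y)=(z,t)$, graded by $|x|=|x'|=0$, $|e_x|=1$, with the superderivation $d$ determined by $d(x)=d(x')=0$, $d(e_x)=x-x'$. Each $B_n$ is an $A$-bimodule by $x\cdot b\cdot y=x'by$ for $x,y\in X$, $b\in B_n$. For an $A$-bimodule $M$ (on which $k$ acts symmetrically), that is, a left module over $A^e=A\otimes_kA^{op}$, put $H^{YB}_n(X,M)=H_n(M\otimes_{A^e}B_\bullet)$ and $H_{YB}^n(X,M)=H^n(\mathrm{Hom}_{A^e}(B_\bullet,M))$.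 The Hochschild (co)homology $H_n(A,M)$, $H^n(A,M)$ is obtained in the same way from the standard complex $A\otimes A^{\otimes n}\otimes A$ with $b'(a_0\otimes\dots\otimes a_{n+1})=\sum_{i=0}^{n}(-1)^i a_0\otimes\dots\otimes a_ia_{i+1}\otimes\dots\otimes a_{n+1}$. Then there are $A$-bimodule maps $\widetilde{\mathrm{Id}}_n:B_n\to A\otimes A^{\otimes n}\otimes A$ $(n\ge 0)$ with $b'\,\widetilde{\mathrm{Id}}_{n+1}=-\widetilde{\mathrm{Id}}_{n}\,d$ (that is, a chain map from $(B,-d)$, which has the same (co)homology as $(B,d)$, to the standard complex), with $\widetilde{\mathrm{Id}}_0(1)=1\otimes 1$ and $\widetilde{\mathrm{Id}}_1(e_x)=1\otimes x\otimes 1$ for $x\in X$. These induce, for every $A$-bimodule $M$ and every $n\ge 0$, $k$-linear maps $$\widetilde{\mathrm{Id}}_*:H^{YB}_n(X,M)\to H_n(A,M),\qquad \widetilde{\mathrm{Id}}^*:H^n(A,M)\to H_{YB}^n(X,M),$$ sending the class of a cycle $z$ to the class of $(\mathrm{id}_M\otimes\widetilde{\mathrm{Id}}_n)(z)$ and the class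 of a cocycle $f$ to the class of $f\circ\widetilde{\mathrm{Id}}_n$. Both are natural in $M$. In degrees $0$ and $1$ both are the identity, in the sense that they are the canonical identifications: they are bijective, $\widetilde{\mathrm{Id}}_*$ sends $[m\otimes 1]$ to $[m\otimes(1\otimes 1)]$ and $[\sum_i m_i\otimes e_{x_i}]$ to $[\sum_i m_i\otimes(1\otimes x_i\otimes 1)]$ (for every cycle of the latter form), and $\widetilde{\mathrm{Id}}^*[f]$ is represented by the cocycle with value $f(1\otimes1)$ at $1$ (degree $0$), respectively $f(1\otimes x\otimes 1)$ at each $e_x$ (degree $1$). -/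

import Mathlib

open scoped TensorProduct

universe u v w

noncomputable section

namespace YangBaxter

/-! ### Bimodules

An `A`-bimodule over the commutative ring `k` (with symmetric `k`-action) is a left module over the
enveloping algebra `A ⊗[k] Aᵐᵒᵖ`. -/

/-- The enveloping algebra `Aᵉ = A ⊗ Aᵒᵖ`. -/
def Env (k : Type u) (A : Type v) [CommRing k] [Ring A] [Algebra k A] : Type _ :=
  A ⊗[k] Aᵐᵒᵖ

instance (k : Type u) (A : Type v) [CommRing k] [Ring A] [Algebra k A] : Ring (Env k A) :=
  inferInstanceAs (Ring (A ⊗[k] Aᵐᵒᵖ))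

instance (k : Type u) (A : Type v) [CommRing k] [Ring A] [Algebra k A] : Algebra k (Env k A) :=
  inferInstanceAs (Algebra k (A ⊗[k] Aᵐᵒᵖ))

/-- The element `a ⊗ c` of `Aᵉ`, acting on a bimodule by `m ↦ a m c`. -/
def Env.tmul (k : Type u) {A : Type v} [CommRing k] [Ring A] [Algebra k A] (a c : A) : Env k A :=
  a ⊗ₜ[k] MulOpposite.op c

theorem Env.tmul_mul_tmul (k : Type u) {A : Type v} [CommRing k] [Ring A] [Algebra k A]
    (a c a' c' : A) : Env.tmul k a c * Env.tmul k a' c' = Env.tmul k (a * a') (c' * c) :=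
  Algebra.TensorProduct.tmul_mul_tmul a a' (MulOpposite.op c) (MulOpposite.op c')

/-- Induction on elements of `Aᵉ`. -/
theorem Env.induction {k : Type u} {A : Type v} [CommRing k] [Ring A] [Algebra k A]
    {P : Env k A → Prop} (zero : P 0) (tmul : ∀ a c, P (Env.tmul k a c))
    (add : ∀ x y, P x → P y → P (x + y)) (e : Env k A) : P e :=
  TensorProduct.induction_on e zero (fun a c => tmul a c.unop) add

section Bimodules

variable (k : Type u) (A : Type v) [CommRing k] [Ring A] [Algebra k A]

/-- The action of `Aᵉ` on an algebra `R` through two algebra maps `l r : A → R`: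
`(a ⊗ c) • b = l a * b * r c`. -/
def envHom {k : Type u} {A : Type v} [CommRing k] [Ring A] [Algebra k A]
    {R : Type*} [Ring R] [Algebra k R] (l r : A →ₐ[k] R) : Env k A →ₐ[k] Module.End k R :=
  Algebra.TensorProduct.lift (A := A) (B := Aᵐᵒᵖ)
    ((Algebra.lsmul k k R).comp l)
    ((Algebra.lsmul k k R).comp (AlgHom.op r))
    (fun a c => by
      refine LinearMap.ext fun b => ?_
      simp [mul_assoc])

theorem envHom_tmul {k : Type u} {A : Type v} [CommRing k] [Ring A] [Algebra k A]
    {R : Type*} [Ring R] [Algebra k R] (l r : A →ₐ[k] R) (a c : A) (b : R) :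
    envHom l r (Env.tmul k a c) b = l a * b * r c := by
  refine (LinearMap.congr_fun (Algebra.TensorProduct.lift_tmul _ _ _ a _) b).trans ?_
  simp [mul_assoc]

/-- The submodule of `M ⊗[k] N` spanned by `m a ⊗ n - m ⊗ a n` and `a m ⊗ n - m ⊗ n a`. -/
def balancing (M N : Type*) [AddCommGroup M] [Module k M] [Module (Env k A) M]
    [AddCommGroup N] [Module k N] [Module (Env k A) N] : Submodule k (M ⊗[k] N) :=
  Submodule.span k
    ({z | ∃ (a : A) (m : M) (n : N),
        z = (Env.tmul k 1 a • m) ⊗ₜ[k] n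
          - m ⊗ₜ[k] (Env.tmul k a 1 • n)} ∪
     {z | ∃ (a : A) (m : M) (n : N),
        z = (Env.tmul k a 1 • m) ⊗ₜ[k] n
          - m ⊗ₜ[k] (Env.tmul k 1 a • n)})

/-- The tensor product `M ⊗_{Aᵉ} N` of two `A`-bimodules. -/
abbrev BimodTensor (M N : Type*) [AddCommGroup M] [Module k M] [Module (Env k A) M]
    [AddCommGroup N] [Module k N] [Module (Env k A) N] : Type _ :=
  (M ⊗[k] N) ⧸ balancing k A M N

/-- The class of `m ⊗ n` in `M ⊗_{Aᵉ} N`. -/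
def bimodTmul {M N : Type*} [AddCommGroup M] [Module k M] [Module (Env k A) M]
    [AddCommGroup N] [Module k N] [Module (Env k A) N] (m : M) (n : N) : BimodTensor k A M N :=
  Submodule.Quotient.mk (m ⊗ₜ[k] n)

section map

variable {k A}
variable {M M' N N' : Type*}
  [AddCommGroup M] [Module k M] [Module (Env k A) M] [IsScalarTower k (Env k A) M]
  [AddCommGroup M'] [Module k M'] [Module (Env k A) M'] [IsScalarTower k (Env k A) M']
  [AddCommGroup N] [Module k N] [Module (Env k A) N] [IsScalarTower k (Env k A) N]
  [AddCommGroup N'] [Module k N'] [Module (Env k A) N'] [IsScalarTower k (Env k A) N']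

/-- The map `f ⊗ g : M ⊗_{Aᵉ} N → M' ⊗_{Aᵉ} N'` induced by two bimodule maps. -/
def bimodMap (f : M →ₗ[Env k A] M') (g : N →ₗ[Env k A] N') :
    BimodTensor k A M N →ₗ[k] BimodTensor k A M' N' :=
  Submodule.mapQ _ _ (TensorProduct.map (f.restrictScalars k) (g.restrictScalars k)) <| by
    rw [balancing, Submodule.span_le]
    rintro z (⟨a, m, n, rfl⟩ | ⟨a, m, n, rfl⟩)
    · refine Submodule.subset_span (Or.inl ⟨a, f m, g n, ?_⟩)
      simp
    · refine Submodule.subset_span (Or.inr ⟨a, f m, g n, ?_⟩)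
      simp

@[simp] theorem bimodMap_tmul (f : M →ₗ[Env k A] M') (g : N →ₗ[Env k A] N') (m : M) (n : N) :
    bimodMap f g (bimodTmul k A m n) = bimodTmul k A (f m) (g n) := rfl

theorem bimodMap_comm (f : M →ₗ[Env k A] M') (g : N →ₗ[Env k A] N')
    (z : BimodTensor k A M N) :
    bimodMap f LinearMap.id (bimodMap LinearMap.id g z)
      = bimodMap LinearMap.id g (bimodMap f LinearMap.id z) := by
  obtain ⟨z, rfl⟩ := Submodule.Quotient.mk_surjective _ z
  induction z using TensorProduct.induction_on with
  | zero => simp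
  | tmul m n => rfl
  | add x y hx hy => simp only [Submodule.Quotient.mk_add, map_add, hx, hy]

end map

end Bimodules

/-! ### (Co)homology of a complex of bimodules with coefficients in a bimodule -/

section Homology

variable {k : Type u} {A : Type v} [CommRing k] [Ring A] [Algebra k A]
variable {C : ℕ → Type w} [∀ n, AddCommGroup (C n)] [∀ n, Module k (C n)]
  [∀ n, Module (Env k A) (C n)] [∀ n, IsScalarTower k (Env k A) (C n)]
variable (d : ∀ n, C (n + 1) →ₗ[Env k A] C n)
variable (M : Type*) [AddCommGroup M] [Module k M] [Module (Env k A) M]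
  [IsScalarTower k (Env k A) M]

/-- The `n`-cycles of `M ⊗_{Aᵉ} C`. -/
def cycles : (n : ℕ) → Submodule k (BimodTensor k A M (C n))
  | 0 => ⊤
  | n + 1 => LinearMap.ker (bimodMap (LinearMap.id : M →ₗ[Env k A] M) (d n))

/-- The `n`-boundaries of `M ⊗_{Aᵉ} C`. -/
def boundaries (n : ℕ) : Submodule k (BimodTensor k A M (C n)) :=
  LinearMap.range (bimodMap (LinearMap.id : M →ₗ[Env k A] M) (d n))

/-- The homology `H_n(M ⊗_{Aᵉ} C)`. -/
abbrev Homology (n : ℕ) : Type _ :=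
  cycles d M n ⧸ (boundaries d M n).submoduleOf (cycles d M n)

/-- The map `Hom_{Aᵉ}(C_n, M) → Hom_{Aᵉ}(C_{n+1}, M)`, `f ↦ f ∘ d`. -/
def coboundary (n : ℕ) : (C n →ₗ[Env k A] M) →ₗ[k] (C (n + 1) →ₗ[Env k A] M) where
  toFun f := f ∘ₗ d n
  map_add' _ _ := rfl
  map_smul' _ _ := rfl

/-- The `n`-cocycles of `Hom_{Aᵉ}(C, M)`. -/
def cocycles (n : ℕ) : Submodule k (C n →ₗ[Env k A] M) :=
  LinearMap.ker (coboundary d M n)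

/-- The `n`-coboundaries of `Hom_{Aᵉ}(C, M)`. -/
def coboundaries : (n : ℕ) → Submodule k (C n →ₗ[Env k A] M)
  | 0 => ⊥
  | n + 1 => LinearMap.range (coboundary d M n)

/-- The cohomology `H^n(Hom_{Aᵉ}(C, M))`. -/
abbrev Cohomology (n : ℕ) : Type _ :=
  cocycles d M n ⧸ (coboundaries d M n).submoduleOf (cocycles d M n)

variable {M}
variable {M' : Type*} [AddCommGroup M'] [Module k M'] [Module (Env k A) M']
  [IsScalarTower k (Env k A) M']

/-- The map induced on cycles by a bimodule map of the coefficients. -/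
def cyclesMap (f : M →ₗ[Env k A] M') (n : ℕ) : cycles d M n →ₗ[k] cycles d M' n :=
  (bimodMap f (LinearMap.id : C n →ₗ[Env k A] C n)).restrict <| by
    intro z hz
    cases n with
    | zero => trivial
    | succ n =>
      have hz' : bimodMap (LinearMap.id : M →ₗ[Env k A] M) (d n) z = 0 := hz
      change bimodMap (LinearMap.id : M' →ₗ[Env k A] M') (d n) _ = 0
      rw [← bimodMap_comm, hz', map_zero]

/-- The map `H_n(M ⊗_{Aᵉ} C) → H_n(M' ⊗_{Aᵉ} C)` induced by a bimodule map `M → M'`. -/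
def homologyCoeffMap (f : M →ₗ[Env k A] M') (n : ℕ) :
    Homology d M n →ₗ[k] Homology d M' n :=
  Submodule.mapQ _ _ (cyclesMap d f n) <| by
    rintro ⟨z, hz⟩ ⟨y, hy⟩
    refine ⟨bimodMap f LinearMap.id y, ?_⟩
    rw [← bimodMap_comm, hy]
    rfl

/-- The map induced on cocycles by a bimodule map of the coefficients. -/
def cocyclesMap (f : M →ₗ[Env k A] M') (n : ℕ) : cocycles d M n →ₗ[k] cocycles d M' n where
  toFun g := ⟨f ∘ₗ g.1, by
    have hg : g.1 ∘ₗ d n = 0 := g.2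
    change (f ∘ₗ g.1) ∘ₗ d n = 0
    rw [LinearMap.comp_assoc, hg, LinearMap.comp_zero]⟩
  map_add' g h := by ext; simp
  map_smul' c g := by ext; simp

/-- The map `H^n(Hom_{Aᵉ}(C, M)) → H^n(Hom_{Aᵉ}(C, M'))` induced by a bimodule map `M → M'`. -/
def cohomologyCoeffMap (f : M →ₗ[Env k A] M') (n : ℕ) :
    Cohomology d M n →ₗ[k] Cohomology d M' n :=
  Submodule.mapQ _ _ (cocyclesMap d f n) <| by
    rintro ⟨g, hg⟩ hgb
    cases n with
    | zero =>
      have h0 : g = 0 := hgb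
      subst h0
      change f ∘ₗ (0 : C 0 →ₗ[Env k A] M) = 0
      simp
    | succ n =>
      obtain ⟨h, hh⟩ := hgb
      refine ⟨f ∘ₗ h, ?_⟩
      change (f ∘ₗ h) ∘ₗ d n = f ∘ₗ g
      have hh' : h ∘ₗ d n = g := hh
      rw [LinearMap.comp_assoc, hh']

variable (M)

/-- The homology class of a cycle. -/
abbrev homologyClass (n : ℕ) (z : cycles d M n) : Homology d M n := Submodule.Quotient.mk z

/-- The cohomology class of a cocycle. -/
abbrev cohomologyClass (n : ℕ) (f : cocycles d M n) : Cohomology d M n := Submodule.Quotient.mk f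

variable {D : ℕ → Type*} [∀ n, AddCommGroup (D n)] [∀ n, Module k (D n)]
  [∀ n, Module (Env k A) (D n)] [∀ n, IsScalarTower k (Env k A) (D n)]
variable (d' : ∀ n, D (n + 1) →ₗ[Env k A] D n)

variable {d d' M} in
/-- `F : H_n(M ⊗_{Aᵉ} C) → H_n(M ⊗_{Aᵉ} D)` is induced by `φ : C_n → D_n`: for every cycle `z`, the
element `(id_M ⊗ φ) z` is a cycle, and `F [z] = [(id_M ⊗ φ) z]`. -/
def InducesHomology {n : ℕ} (φ : C n →ₗ[Env k A] D n)
    (F : Homology d M n →ₗ[k] Homology d' M n) : Prop :=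
  ∀ z : cycles d M n, ∃ hz : bimodMap (LinearMap.id : M →ₗ[Env k A] M) φ z.1 ∈ cycles d' M n,
    F (homologyClass d M n z) = homologyClass d' M n ⟨_, hz⟩

variable {d d' M} in
/-- `G : H^n(Hom_{Aᵉ}(D, M)) → H^n(Hom_{Aᵉ}(C, M))` is induced by `φ : C_n → D_n`: for every
cocycle `g`, the map `g ∘ φ` is a cocycle, and `G [g] = [g ∘ φ]`. -/
def InducesCohomology {n : ℕ} (φ : C n →ₗ[Env k A] D n)
    (G : Cohomology d' M n →ₗ[k] Cohomology d M n) : Prop :=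
  ∀ g : cocycles d' M n, ∃ hg : g.1 ∘ₗ φ ∈ cocycles d M n,
    G (cohomologyClass d' M n g) = cohomologyClass d M n ⟨_, hg⟩

end Homology

/-! ### The standard (bar) resolution and Hochschild (co)homology -/

section Bar

variable (k : Type u) (A : Type v) [CommRing k] [Ring A] [Algebra k A]

/-- `Bar k A n` is `A ⊗ A^{⊗ n} ⊗ A`, as an `A`-bimodule (through the two outer factors). The
factorwise ring structure of this tensor product serves only to write the bimodule structure. -/
abbrev Bar (n : ℕ) : Type _ := ⨂[k] _ : Fin (n + 2), A

/-- The element `a_0 ⊗ a_1 ⊗ ⋯ ⊗ a_{n+1}`. -/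
def Bar.tprod {n : ℕ} (a : Fin (n + 2) → A) : Bar k A n := PiTensorProduct.tprod k a

/-- The algebra map inserting `a` in the `i`-th factor and `1` elsewhere. -/
def Bar.single {n : ℕ} (i : Fin (n + 2)) : A →ₐ[k] Bar k A n :=
  PiTensorProduct.singleAlgHom (R := k) (A := fun _ : Fin (n + 2) => A) i

/-- `a · (a_0 ⊗ ⋯ ⊗ a_{n+1}) · c = a a_0 ⊗ a_1 ⊗ ⋯ ⊗ a_n ⊗ a_{n+1} c`. -/
instance (n : ℕ) : Module (Env k A) (Bar k A n) :=
  Module.compHom _ (envHom (Bar.single k A (n := n) 0)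
    (Bar.single k A (Fin.last (n + 1)))).toRingHom

variable {k A}

theorem Bar.smul_def {n : ℕ} (e : Env k A) (w : Bar k A n) :
    e • w = envHom (Bar.single k A (n := n) 0) (Bar.single k A (Fin.last (n + 1))) e w := rfl

instance (n : ℕ) : IsScalarTower k (Env k A) (Bar k A n) where
  smul_assoc c e w := by simp only [Bar.smul_def, map_smul, LinearMap.smul_apply]

theorem Bar.tmul_smul {n : ℕ} (a c : A) (v : Fin (n + 2) → A) :
    Env.tmul k a c • Bar.tprod k A v
      = Bar.tprod k A (Function.update (Function.update v 0 (a * v 0)) (Fin.last (n + 1))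
          (v (Fin.last (n + 1)) * c)) := by
  rw [Bar.smul_def, envHom_tmul]
  simp only [Bar.single, Bar.tprod, PiTensorProduct.singleAlgHom_apply]
  rw [PiTensorProduct.tprod_mul_tprod, PiTensorProduct.tprod_mul_tprod]
  congr 1
  have h0 : (0 : Fin (n + 2)) ≠ Fin.last (n + 1) := (Fin.last_pos).ne
  funext i
  by_cases hl : i = Fin.last (n + 1)
  · subst hl
    simp [Pi.mulSingle, h0.symm]
  · by_cases h : i = 0
    · subst h
      simp [Pi.mulSingle, h0]
    · simp [Pi.mulSingle, h, hl]

theorem contractNth_update {n : ℕ} (j : Fin (n + 2)) (v : Fin (n + 3) → A) (p : Fin (n + 3))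
    (a : A) :
    j.castSucc.contractNth (· * ·) (Function.update v p a)
      = Function.update (j.castSucc.contractNth (· * ·) v) (j.predAbove p)
          (if p = j.castSucc then a * v j.succ else if p = j.succ then v j.castSucc * a else a) := by
  have hp : p = j.castSucc ∨ p = j.succ ∨ p < j.castSucc ∨ j.succ < p := by
    simp only [Fin.ext_iff, Fin.lt_def, Fin.val_castSucc, Fin.val_succ]; omega
  have hpa : ((j.predAbove p : Fin (n + 2)) : ℕ) = if (j : ℕ) < p then (p : ℕ) - 1 else p := by
    rw [Fin.predAbove]
    split_ifs with h1 h2 h2 <;> simp only [Fin.lt_def, Fin.val_castSucc] at h1 <;>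
      simp <;> omega
  funext i
  simp only [Fin.contractNth, Function.update_apply, Fin.ext_iff, Fin.val_castSucc, Fin.val_succ,
    hpa] at *
  split_ifs <;> first | rfl | omega | skip
  all_goals
    obtain rfl : i = j := Fin.ext ‹_›
    rfl

/-- The multilinear map `(a_0, …, a_{n+2}) ↦ a_0 ⊗ ⋯ ⊗ a_j a_{j+1} ⊗ ⋯ ⊗ a_{n+2}`. -/
def Bar.faceMultilinear (n : ℕ) (j : Fin (n + 2)) :
    MultilinearMap k (fun _ : Fin (n + 3) => A) (Bar k A n) where
  toFun v := Bar.tprod k A (j.castSucc.contractNth (· * ·) v)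
  map_update_add' := by
    intro inst v p a b
    rw [Subsingleton.elim inst (instDecidableEqFin _)]
    simp only [Bar.tprod, contractNth_update]
    rw [← MultilinearMap.map_update_add]
    congr 2
    split_ifs <;> simp [add_mul, mul_add]
  map_update_smul' := by
    intro inst v p c a
    rw [Subsingleton.elim inst (instDecidableEqFin _)]
    simp only [Bar.tprod, contractNth_update]
    rw [← MultilinearMap.map_update_smul]
    congr 2
    split_ifs <;> simp

/-- The linear map `a_0 ⊗ ⋯ ⊗ a_{n+2} ↦ a_0 ⊗ ⋯ ⊗ a_j a_{j+1} ⊗ ⋯ ⊗ a_{n+2}`. -/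
def Bar.face (n : ℕ) (j : Fin (n + 2)) : Bar k A (n + 1) →ₗ[k] Bar k A n :=
  PiTensorProduct.lift (Bar.faceMultilinear n j)

theorem Bar.face_tprod {n : ℕ} (j : Fin (n + 2)) (v : Fin (n + 3) → A) :
    Bar.face (k := k) n j (Bar.tprod k A v)
      = Bar.tprod k A (j.castSucc.contractNth (· * ·) v) :=
  PiTensorProduct.lift.tprod _

theorem Bar.face_smul {n : ℕ} (j : Fin (n + 2)) (e : Env k A) (w : Bar k A (n + 1)) :
    Bar.face n j (e • w) = e • Bar.face n j w := by
  induction w using PiTensorProduct.induction_on with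
  | add x y hx hy => rw [smul_add, map_add, hx, hy, map_add, smul_add]
  | smul_tprod r v =>
    rw [smul_comm e r, (Bar.face n j).map_smul r, (Bar.face n j).map_smul r, smul_comm e r]
    congr 1
    induction e using Env.induction with
    | zero =>
      rw [zero_smul, zero_smul]
      exact (Bar.face n j).map_zero
    | add x y hx hy => rw [add_smul, map_add, hx, hy, add_smul]
    | tmul a c =>
      change Bar.face n j (Env.tmul k a c • Bar.tprod k A v)
        = Env.tmul k a c • Bar.face n j (Bar.tprod k A v)
      rw [Bar.face_tprod, Bar.tmul_smul, Bar.tmul_smul, Bar.face_tprod]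
      congr 1
      rw [contractNth_update, contractNth_update]
      have e0 : j.predAbove (0 : Fin (n + 3)) = 0 := by simp
      have e1 : j.predAbove (Fin.last (n + 2)) = Fin.last (n + 1) := by simp
      rw [e0, e1]
      have h0 : (0 : Fin (n + 2)) ≠ Fin.last (n + 1) := (Fin.last_pos).ne
      funext i
      by_cases hl : i = Fin.last (n + 1)
      · subst hl
        rw [Function.update_self, Function.update_self]
        have hj1 : Fin.last (n + 1 + 1) ≠ j.castSucc := (Fin.castSucc_lt_last j).ne'
        rw [if_neg hj1]
        by_cases hj : j = Fin.last (n + 1)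
        · subst hj
          simp [Fin.contractNth, mul_assoc]
        · have hj2 : Fin.last (n + 1 + 1) ≠ j.succ := by
            intro h
            exact hj (Fin.succ_injective _ (h.symm.trans (Fin.succ_last _).symm))
          have hj3 : (j : ℕ) < n + 1 := Fin.val_lt_last hj
          rw [if_neg hj2]
          simp [Fin.contractNth, hj3.ne', hj3.not_gt]
      · rw [Function.update_of_ne hl, Function.update_of_ne hl]
        by_cases h : i = 0
        · subst h
          rw [Function.update_self, Function.update_self]
          by_cases hj : j = 0
          · subst hj
            simp [Fin.contractNth, mul_assoc]
          · have hj1 : (0 : Fin (n + 3)) ≠ j.castSucc := by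
              intro h
              exact hj (Fin.castSucc_injective _ (h.symm.trans Fin.castSucc_zero.symm))
            have hj2 : (0 : Fin (n + 3)) ≠ j.succ := (Fin.succ_ne_zero j).symm
            have hj3 : 0 < (j : ℕ) := Nat.pos_of_ne_zero fun h => hj (Fin.ext h)
            rw [if_neg hj1, if_neg hj2]
            simp [Fin.contractNth, hj3]
        · rw [Function.update_of_ne h, Function.update_of_ne h]

/-- The differential `b'` of the standard resolution,
`b'(a_0 ⊗ ⋯ ⊗ a_{n+2}) = ∑_{j=0}^{n+1} (-1)^j a_0 ⊗ ⋯ ⊗ a_j a_{j+1} ⊗ ⋯ ⊗ a_{n+2}`. -/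
def Bar.d (k : Type u) (A : Type v) [CommRing k] [Ring A] [Algebra k A] (n : ℕ) :
    Bar k A (n + 1) →ₗ[Env k A] Bar k A n where
  toFun w := ∑ j : Fin (n + 2), (-1 : k) ^ (j : ℕ) • Bar.face n j w
  map_add' x y := by simp [Finset.sum_add_distrib]
  map_smul' e x := by
    simp only [Bar.face_smul, RingHom.id_apply, Finset.smul_sum]
    exact Finset.sum_congr rfl fun j _ => smul_comm _ _ _

end Bar

/-! ### Set-theoretical solutions, the algebra `A` and the differential graded algebra `B` -/

section Solution

/-- `σ` satisfies the Yang–Baxter equation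
`(Id × σ)(σ × Id)(Id × σ) = (σ × Id)(Id × σ)(σ × Id)` on `X × X × X`. -/
def IsSolution {X : Type w} (σ : X × X ≃ X × X) : Prop :=
  let id_σ : X × X × X → X × X × X := fun p => (p.1, σ p.2)
  let σ_id : X × X × X → X × X × X := fun p =>
    ((σ (p.1, p.2.1)).1, (σ (p.1, p.2.1)).2, p.2.2)
  id_σ ∘ σ_id ∘ id_σ = σ_id ∘ id_σ ∘ σ_id

variable (k : Type u) [CommRing k] {X : Type w} (σ : X × X ≃ X × X)

/-- The relations `x y = z t`, for `σ (x, y) = (z, t)`. -/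
inductive ARel : FreeAlgebra k X → FreeAlgebra k X → Prop
  | xy (x y : X) : ARel
      (FreeAlgebra.ι k x * FreeAlgebra.ι k y)
      (FreeAlgebra.ι k (σ (x, y)).1 * FreeAlgebra.ι k (σ (x, y)).2)

/-- The algebra `A = k⟨X⟩ / (x y = z t : σ (x, y) = (z, t))`. -/
def AAlg : Type _ := RingQuot (ARel k σ)

instance : Ring (AAlg k σ) := inferInstanceAs (Ring (RingQuot (ARel k σ)))
instance : Algebra k (AAlg k σ) := inferInstanceAs (Algebra k (RingQuot (ARel k σ)))

/-- The quotient map `k⟨X⟩ → A`. -/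
def AAlg.mk : FreeAlgebra k X →ₐ[k] AAlg k σ := RingQuot.mkAlgHom k (ARel k σ)

/-- The generator `x` of `A`. -/
def AAlg.x (x : X) : AAlg k σ := AAlg.mk k σ (FreeAlgebra.ι k x)

theorem AAlg.mk_surjective : Function.Surjective (AAlg.mk k σ) :=
  RingQuot.mkAlgHom_surjective k (ARel k σ)

/-- An algebra map out of `A` is given by images of the generators satisfying the relations. -/
def AAlg.lift {R : Type*} [Ring R] [Algebra k R] (f : X → R)
    (h : ∀ x y, f x * f y = f (σ (x, y)).1 * f (σ (x, y)).2) : AAlg k σ →ₐ[k] R :=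
  RingQuot.liftAlgHom k ⟨FreeAlgebra.lift k f, by
    rintro _ _ ⟨x, y⟩
    simpa using h x y⟩

theorem AAlg.lift_x {R : Type*} [Ring R] [Algebra k R] (f : X → R)
    (h : ∀ x y, f x * f y = f (σ (x, y)).1 * f (σ (x, y)).2) (x : X) :
    AAlg.lift k σ f h (AAlg.x k σ x) = f x :=
  (RingQuot.liftAlgHom_mkAlgHom_apply k _ _ _).trans (FreeAlgebra.lift_ι_apply _ _)

/-- The three kinds of generators `x`, `x'`, `e_x` of `B`. -/
inductive Gen (X : Type w) : Type w
  | x : X → Gen X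
  | x' : X → Gen X
  | e : X → Gen X

/-- The degree of a generator: `|x| = |x'| = 0`, `|e_x| = 1`. -/
def Gen.deg {X : Type w} : Gen X → ℕ
  | .x _ => 0
  | .x' _ => 0
  | .e _ => 1

/-- The defining relations of `B`: for `σ (x, y) = (z, t)`,
`x y = z t`, `x y' = z' t`, `x' y' = z' t'`, `x e_y = e_z t`, `e_x y' = z' e_t`. -/
inductive BRel : FreeAlgebra k (Gen X) → FreeAlgebra k (Gen X) → Prop
  | xx (x y : X) : BRel
      (FreeAlgebra.ι k (.x x) * FreeAlgebra.ι k (.x y))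
      (FreeAlgebra.ι k (.x (σ (x, y)).1) * FreeAlgebra.ι k (.x (σ (x, y)).2))
  | xx' (x y : X) : BRel
      (FreeAlgebra.ι k (.x x) * FreeAlgebra.ι k (.x' y))
      (FreeAlgebra.ι k (.x' (σ (x, y)).1) * FreeAlgebra.ι k (.x (σ (x, y)).2))
  | x'x' (x y : X) : BRel
      (FreeAlgebra.ι k (.x' x) * FreeAlgebra.ι k (.x' y))
      (FreeAlgebra.ι k (.x' (σ (x, y)).1) * FreeAlgebra.ι k (.x' (σ (x, y)).2))
  | xe (x y : X) : BRel
      (FreeAlgebra.ι k (.x x) * FreeAlgebra.ι k (.e y))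
      (FreeAlgebra.ι k (.e (σ (x, y)).1) * FreeAlgebra.ι k (.x (σ (x, y)).2))
  | ex' (x y : X) : BRel
      (FreeAlgebra.ι k (.e x) * FreeAlgebra.ι k (.x' y))
      (FreeAlgebra.ι k (.x' (σ (x, y)).1) * FreeAlgebra.ι k (.e (σ (x, y)).2))

/-- The algebra `B = B(X, σ)`. -/
def BAlg : Type _ := RingQuot (BRel k σ)

instance : Ring (BAlg k σ) := inferInstanceAs (Ring (RingQuot (BRel k σ)))
instance : Algebra k (BAlg k σ) := inferInstanceAs (Algebra k (RingQuot (BRel k σ)))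

/-- The quotient map from the free algebra to `B`. -/
def BAlg.mk : FreeAlgebra k (Gen X) →ₐ[k] BAlg k σ := RingQuot.mkAlgHom k (BRel k σ)

/-- The generators of `B`. -/
def BAlg.gen (g : Gen X) : BAlg k σ := BAlg.mk k σ (FreeAlgebra.ι k g)

theorem BAlg.mk_surjective : Function.Surjective (BAlg.mk k σ) :=
  RingQuot.mkAlgHom_surjective k (BRel k σ)

/-- The property that the images `f g` of the generators of `B` satisfy the relations. -/
structure BAlg.Compat {R : Type*} [Ring R] (f : Gen X → R) : Prop where
  xx (x y : X) : f (.x x) * f (.x y) = f (.x (σ (x, y)).1) * f (.x (σ (x, y)).2)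
  xx' (x y : X) : f (.x x) * f (.x' y) = f (.x' (σ (x, y)).1) * f (.x (σ (x, y)).2)
  x'x' (x y : X) : f (.x' x) * f (.x' y) = f (.x' (σ (x, y)).1) * f (.x' (σ (x, y)).2)
  xe (x y : X) : f (.x x) * f (.e y) = f (.e (σ (x, y)).1) * f (.x (σ (x, y)).2)
  ex' (x y : X) : f (.e x) * f (.x' y) = f (.x' (σ (x, y)).1) * f (.e (σ (x, y)).2)

/-- An algebra map out of `B` is given by images of the generators satisfying the relations. -/
def BAlg.lift {R : Type*} [Ring R] [Algebra k R] (f : Gen X → R) (h : BAlg.Compat σ f) :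
    BAlg k σ →ₐ[k] R :=
  RingQuot.liftAlgHom k ⟨FreeAlgebra.lift k f, by
    rintro _ _ (⟨x, y⟩ | ⟨x, y⟩ | ⟨x, y⟩ | ⟨x, y⟩ | ⟨x, y⟩)
    · simpa using h.xx x y
    · simpa using h.xx' x y
    · simpa using h.x'x' x y
    · simpa using h.xe x y
    · simpa using h.ex' x y⟩

theorem BAlg.lift_gen {R : Type*} [Ring R] [Algebra k R] (f : Gen X → R)
    (h : BAlg.Compat σ f) (g : Gen X) : BAlg.lift k σ f h (BAlg.gen k σ g) = f g :=
  (RingQuot.liftAlgHom_mkAlgHom_apply k _ _ _).trans (FreeAlgebra.lift_ι_apply _ _)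

theorem BAlg.gen_compat : BAlg.Compat σ (BAlg.gen k σ) where
  xx x y := by
    have := RingQuot.mkAlgHom_rel k (BRel.xx (k := k) (σ := σ) x y)
    rw [map_mul, map_mul] at this; exact this
  xx' x y := by
    have := RingQuot.mkAlgHom_rel k (BRel.xx' (k := k) (σ := σ) x y)
    rw [map_mul, map_mul] at this; exact this
  x'x' x y := by
    have := RingQuot.mkAlgHom_rel k (BRel.x'x' (k := k) (σ := σ) x y)
    rw [map_mul, map_mul] at this; exact this
  xe x y := by
    have := RingQuot.mkAlgHom_rel k (BRel.xe (k := k) (σ := σ) x y)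
    rw [map_mul, map_mul] at this; exact this
  ex' x y := by
    have := RingQuot.mkAlgHom_rel k (BRel.ex' (k := k) (σ := σ) x y)
    rw [map_mul, map_mul] at this; exact this

/-- Induction on elements of `B`. -/
theorem BAlg.induction {P : BAlg k σ → Prop}
    (scalar : ∀ r : k, P (algebraMap k _ r)) (gen : ∀ g, P (BAlg.gen k σ g))
    (mul : ∀ a b, P a → P b → P (a * b)) (add : ∀ a b, P a → P b → P (a + b))
    (b : BAlg k σ) : P b := by
  obtain ⟨b, rfl⟩ := BAlg.mk_surjective k σ b
  induction b using FreeAlgebra.induction with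
  | grade0 r => rw [AlgHom.commutes]; exact scalar r
  | grade1 g => exact gen g
  | mul a b ha hb => rw [map_mul]; exact mul _ _ ha hb
  | add a b ha hb => rw [map_add]; exact add _ _ ha hb

/-- The algebra map `A → B`, `x ↦ x`. -/
def incl : AAlg k σ →ₐ[k] BAlg k σ :=
  AAlg.lift k σ (fun x => BAlg.gen k σ (.x x)) (BAlg.gen_compat k σ).xx

/-- The algebra map `A → B`, `x ↦ x'`. -/
def incl' : AAlg k σ →ₐ[k] BAlg k σ :=
  AAlg.lift k σ (fun x => BAlg.gen k σ (.x' x)) (BAlg.gen_compat k σ).x'x'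

/-- `B` as an `A`-bimodule (an `A'`-`A`-bimodule, where `A' ≅ A` via `x' ↔ x`):
`x · b · y = x' b y`. -/
instance : Module (Env k (AAlg k σ)) (BAlg k σ) :=
  Module.compHom _ (envHom (incl' k σ) (incl k σ)).toRingHom

theorem BAlg.smul_def (e : Env k (AAlg k σ)) (b : BAlg k σ) :
    e • b = envHom (incl' k σ) (incl k σ) e b := rfl

theorem BAlg.tmul_smul (a c : AAlg k σ) (b : BAlg k σ) :
    Env.tmul k a c • b = incl' k σ a * b * incl k σ c := by
  rw [BAlg.smul_def, envHom_tmul]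

instance : IsScalarTower k (Env k (AAlg k σ)) (BAlg k σ) where
  smul_assoc c e b := by simp only [BAlg.smul_def, map_smul, LinearMap.smul_apply]

/-- The sign automorphism `b ↦ (-1)^{|b|} b` of `B`. -/
def sign : BAlg k σ →ₐ[k] BAlg k σ :=
  BAlg.lift k σ (fun g => (-1 : BAlg k σ) ^ g.deg * BAlg.gen k σ g) <| by
    have h := BAlg.gen_compat k σ
    constructor <;> intro x y <;>
      simp [Gen.deg, h.xx x y, h.xx' x y, h.x'x' x y, h.xe x y, h.ex' x y]

theorem sign_gen (g : Gen X) :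
    sign k σ (BAlg.gen k σ g) = (-1 : BAlg k σ) ^ g.deg * BAlg.gen k σ g :=
  BAlg.lift_gen k σ _ _ _

/-- The values of the differential on the generators: `d x = d x' = 0`, `d e_x = x - x'`. -/
def dGen : Gen X → BAlg k σ
  | .x _ => 0
  | .x' _ => 0
  | .e x => BAlg.gen k σ (.x x) - BAlg.gen k σ (.x' x)

/-- The algebra map `b ↦ !![(-1)^{|b|} b, d b; 0, b]`, whose multiplicativity says that `d` is a
superderivation. -/
def dMat : BAlg k σ →ₐ[k] Matrix (Fin 2) (Fin 2) (BAlg k σ) :=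
  BAlg.lift k σ (fun g => !![sign k σ (BAlg.gen k σ g), dGen k σ g; 0, BAlg.gen k σ g]) <| by
    have h := BAlg.gen_compat k σ
    constructor <;> intro x y <;>
      simp [sign_gen, dGen, Gen.deg, h.xx x y, h.xx' x y, h.x'x' x y, h.xe x y, h.ex' x y,
        mul_sub, sub_mul]

theorem dMat_gen (g : Gen X) :
    dMat k σ (BAlg.gen k σ g)
      = !![sign k σ (BAlg.gen k σ g), dGen k σ g; 0, BAlg.gen k σ g] :=
  BAlg.lift_gen k σ _ _ _

theorem dMat_eq (b : BAlg k σ) :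
    dMat k σ b = !![sign k σ b, dMat k σ b 0 1; 0, b] := by
  induction b using BAlg.induction k σ with
  | scalar r =>
    rw [AlgHom.commutes, AlgHom.commutes]
    ext i j
    fin_cases i <;> fin_cases j <;> simp [Matrix.algebraMap_matrix_apply]
  | gen g => simp [dMat_gen]
  | mul a b ha hb =>
    rw [map_mul, ha, hb]
    simp
  | add a b ha hb =>
    rw [map_add, ha, hb]
    ext i j
    fin_cases i <;> fin_cases j <;> simp

/-- The differential of `B`, as a `k`-linear map: the superderivation with `d x = d x' = 0` and
`d e_x = x - x'`. -/
def dLin : BAlg k σ →ₗ[k] BAlg k σ where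
  toFun b := dMat k σ b 0 1
  map_add' a b := by simp
  map_smul' c b := by simp

theorem dLin_gen (g : Gen X) : dLin k σ (BAlg.gen k σ g) = dGen k σ g := by
  simp [dLin, dMat_gen]

theorem dLin_mul (a b : BAlg k σ) :
    dLin k σ (a * b) = dLin k σ a * b + sign k σ a * dLin k σ b := by
  change dMat k σ (a * b) 0 1 = dMat k σ a 0 1 * b + sign k σ a * dMat k σ b 0 1
  rw [map_mul, dMat_eq k σ a, dMat_eq k σ b]
  simp [add_comm]

/-- Induction on elements of `A`. -/
theorem AAlg.induction {P : AAlg k σ → Prop}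
    (scalar : ∀ r : k, P (algebraMap k _ r)) (gen : ∀ x, P (AAlg.x k σ x))
    (mul : ∀ a b, P a → P b → P (a * b)) (add : ∀ a b, P a → P b → P (a + b))
    (a : AAlg k σ) : P a := by
  obtain ⟨a, rfl⟩ := AAlg.mk_surjective k σ a
  induction a using FreeAlgebra.induction with
  | grade0 r => rw [AlgHom.commutes]; exact scalar r
  | grade1 x => exact gen x
  | mul a b ha hb => rw [map_mul]; exact mul _ _ ha hb
  | add a b ha hb => rw [map_add]; exact add _ _ ha hb

theorem incl_x (x : X) : incl k σ (AAlg.x k σ x) = BAlg.gen k σ (.x x) :=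
  AAlg.lift_x k σ _ _ x

theorem incl'_x (x : X) : incl' k σ (AAlg.x k σ x) = BAlg.gen k σ (.x' x) :=
  AAlg.lift_x k σ _ _ x

theorem dLin_algebraMap (r : k) : dLin k σ (algebraMap k _ r) = 0 := by
  change dMat k σ (algebraMap k _ r) 0 1 = 0
  rw [AlgHom.commutes]
  simp [Matrix.algebraMap_matrix_apply]

theorem dLin_incl (a : AAlg k σ) : dLin k σ (incl k σ a) = 0 := by
  induction a using AAlg.induction k σ with
  | scalar r => rw [AlgHom.commutes, dLin_algebraMap]
  | gen x => rw [incl_x, dLin_gen]; rfl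
  | mul a b ha hb => rw [map_mul, dLin_mul, ha, hb, zero_mul, mul_zero, add_zero]
  | add a b ha hb => rw [map_add, map_add, ha, hb, add_zero]

theorem dLin_incl' (a : AAlg k σ) : dLin k σ (incl' k σ a) = 0 := by
  induction a using AAlg.induction k σ with
  | scalar r => rw [AlgHom.commutes, dLin_algebraMap]
  | gen x => rw [incl'_x, dLin_gen]; rfl
  | mul a b ha hb => rw [map_mul, dLin_mul, ha, hb, zero_mul, mul_zero, add_zero]
  | add a b ha hb => rw [map_add, map_add, ha, hb, add_zero]

theorem sign_incl' (a : AAlg k σ) : sign k σ (incl' k σ a) = incl' k σ a := by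
  induction a using AAlg.induction k σ with
  | scalar r => rw [AlgHom.commutes, AlgHom.commutes]
  | gen x => rw [incl'_x, sign_gen]; simp [Gen.deg]
  | mul a b ha hb => rw [map_mul, map_mul, ha, hb]
  | add a b ha hb => rw [map_add, map_add, ha, hb]

/-- The differential `d : B → B` as a map of `A`-bimodules. -/
def dB : BAlg k σ →ₗ[Env k (AAlg k σ)] BAlg k σ where
  toFun := dLin k σ
  map_add' := map_add _
  map_smul' e b := by
    rw [RingHom.id_apply]
    induction e using Env.induction with
    | zero =>
      rw [zero_smul, zero_smul, map_zero]
    | add x y hx hy => rw [add_smul, map_add, hx, hy, add_smul]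
    | tmul a c =>
      rw [BAlg.tmul_smul, BAlg.tmul_smul, dLin_mul, dLin_mul, dLin_incl, dLin_incl', sign_incl',
        zero_mul, zero_add, mul_zero, add_zero]

/-- The product of a word in the generators of `B`. -/
def word (l : List (Gen X)) : BAlg k σ := (l.map (BAlg.gen k σ)).prod

/-- The `k`-span of the words with exactly `n` letters of the form `e_x`. -/
def wordSpan (n : ℕ) : Submodule k (BAlg k σ) :=
  Submodule.span k {b | ∃ l : List (Gen X), (l.map Gen.deg).sum = n ∧ b = word k σ l}

theorem gen_mul_mem {n m : ℕ} (g : Gen X) {b : BAlg k σ} (hb : b ∈ wordSpan k σ n)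
    (hm : g.deg + n = m) : BAlg.gen k σ g * b ∈ wordSpan k σ m := by
  induction hb using Submodule.span_induction with
  | mem b h =>
    obtain ⟨l, hl, rfl⟩ := h
    exact Submodule.subset_span ⟨g :: l, by simp [hl, hm], by simp [word]⟩
  | zero => rw [mul_zero]; exact zero_mem _
  | add x y _ _ hx hy => rw [mul_add]; exact add_mem hx hy
  | smul c x _ hx => rw [mul_smul_comm]; exact Submodule.smul_mem _ _ hx

theorem mul_gen_mem {n m : ℕ} (g : Gen X) {b : BAlg k σ} (hb : b ∈ wordSpan k σ n)
    (hm : n + g.deg = m) : b * BAlg.gen k σ g ∈ wordSpan k σ m := by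
  induction hb using Submodule.span_induction with
  | mem b h =>
    obtain ⟨l, hl, rfl⟩ := h
    exact Submodule.subset_span ⟨l ++ [g], by simp [hl, hm], by simp [word]⟩
  | zero => rw [zero_mul]; exact zero_mem _
  | add x y _ _ hx hy => rw [add_mul]; exact add_mem hx hy
  | smul c x _ hx => rw [smul_mul_assoc]; exact Submodule.smul_mem _ _ hx

theorem incl'_mul_mem {n : ℕ} (a : AAlg k σ) :
    ∀ b ∈ wordSpan k σ n, incl' k σ a * b ∈ wordSpan k σ n := by
  induction a using AAlg.induction k σ with
  | scalar r =>
    intro b hb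
    rw [AlgHom.commutes, ← Algebra.smul_def]
    exact Submodule.smul_mem _ _ hb
  | gen x => intro b hb; rw [incl'_x]; exact gen_mul_mem k σ _ hb (by simp [Gen.deg])
  | mul a c ha hc => intro b hb; rw [map_mul, mul_assoc]; exact ha _ (hc _ hb)
  | add a c ha hc => intro b hb; rw [map_add, add_mul]; exact add_mem (ha _ hb) (hc _ hb)

theorem mul_incl_mem {n : ℕ} (a : AAlg k σ) :
    ∀ b ∈ wordSpan k σ n, b * incl k σ a ∈ wordSpan k σ n := by
  induction a using AAlg.induction k σ with
  | scalar r =>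
    intro b hb
    rw [AlgHom.commutes, ← Algebra.commutes, ← Algebra.smul_def]
    exact Submodule.smul_mem _ _ hb
  | gen x => intro b hb; rw [incl_x]; exact mul_gen_mem k σ _ hb (by simp [Gen.deg])
  | mul a c ha hc => intro b hb; rw [map_mul, ← mul_assoc]; exact hc _ (ha _ hb)
  | add a c ha hc => intro b hb; rw [map_add, mul_add]; exact add_mem (ha _ hb) (hc _ hb)

/-- The homogeneous component `B_n` of `B`: the span of the words with exactly `n` letters
`e_x`. -/
def BDeg (n : ℕ) : Submodule (Env k (AAlg k σ)) (BAlg k σ) where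
  carrier := wordSpan k σ n
  add_mem' := add_mem
  zero_mem' := zero_mem _
  smul_mem' e b hb := by
    change e • b ∈ wordSpan k σ n
    induction e using Env.induction with
    | zero =>
      rw [zero_smul]; exact zero_mem _
    | add x y hx hy => rw [add_smul]; exact add_mem hx hy
    | tmul a c =>
      rw [BAlg.tmul_smul]
      exact mul_incl_mem k σ c _ (incl'_mul_mem k σ a _ hb)

theorem word_mem (l : List (Gen X)) : word k σ l ∈ BDeg k σ (l.map Gen.deg).sum :=
  Submodule.subset_span ⟨l, rfl, rfl⟩

theorem dLin_word (l : List (Gen X)) :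
    (∀ n, (l.map Gen.deg).sum = n + 1 → dLin k σ (word k σ l) ∈ wordSpan k σ n) ∧
    ((l.map Gen.deg).sum = 0 → dLin k σ (word k σ l) = 0) := by
  induction l with
  | nil =>
    have h : dLin k σ (word k σ []) = 0 := by simpa [word] using dLin_algebraMap k σ 1
    exact ⟨fun n hn => by simp at hn, fun _ => h⟩
  | cons g l ih =>
    have hw : word k σ (g :: l) = BAlg.gen k σ g * word k σ l := by simp [word]
    have hl : word k σ l ∈ wordSpan k σ (l.map Gen.deg).sum := word_mem k σ l
    rw [hw, dLin_mul, dLin_gen, sign_gen]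
    cases g with
    | x x =>
      simp only [dGen, Gen.deg, List.map_cons, List.sum_cons, zero_add, zero_mul, pow_zero,
        one_mul]
      exact ⟨fun n hn => gen_mul_mem k σ _ (ih.1 n hn) (by simp [Gen.deg]),
        fun h => by rw [ih.2 h, mul_zero]⟩
    | x' x =>
      simp only [dGen, Gen.deg, List.map_cons, List.sum_cons, zero_add, zero_mul, pow_zero,
        one_mul]
      exact ⟨fun n hn => gen_mul_mem k σ _ (ih.1 n hn) (by simp [Gen.deg]),
        fun h => by rw [ih.2 h, mul_zero]⟩
    | e x =>
      simp only [dGen, Gen.deg, List.map_cons, List.sum_cons, pow_one]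
      refine ⟨fun n hn => ?_, fun h => by omega⟩
      have hn' : (l.map Gen.deg).sum = n := by omega
      refine add_mem ?_ ?_
      · rw [sub_mul]
        exact sub_mem (gen_mul_mem k σ _ hl (by simp [Gen.deg, hn']))
          (gen_mul_mem k σ _ hl (by simp [Gen.deg, hn']))
      · rw [neg_mul, one_mul, neg_mul]
        refine neg_mem ?_
        cases n with
        | zero => rw [ih.2 hn', mul_zero]; exact zero_mem _
        | succ n => exact gen_mul_mem k σ _ (ih.1 n hn') (by simp [Gen.deg, add_comm])

theorem dB_mem (n : ℕ) : ∀ b ∈ BDeg k σ (n + 1), dB k σ b ∈ BDeg k σ n := by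
  intro b hb
  change b ∈ wordSpan k σ (n + 1) at hb
  change dLin k σ b ∈ wordSpan k σ n
  induction hb using Submodule.span_induction with
  | mem b h =>
    obtain ⟨l, hl, rfl⟩ := h
    exact (dLin_word k σ l).1 n hl
  | zero => rw [map_zero]; exact zero_mem _
  | add x y _ _ hx hy => rw [map_add]; exact add_mem hx hy
  | smul c x _ hx => rw [map_smul]; exact Submodule.smul_mem _ _ hx

/-- The `A`-bimodule `B_n`. -/
def BPiece (n : ℕ) : Type _ := BDeg k σ n

instance (n : ℕ) : AddCommGroup (BPiece k σ n) := inferInstanceAs (AddCommGroup (BDeg k σ n))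

instance (n : ℕ) : Module k (BPiece k σ n) := inferInstanceAs (Module k (BDeg k σ n))

instance (n : ℕ) : Module (Env k (AAlg k σ)) (BPiece k σ n) :=
  inferInstanceAs (Module (Env k (AAlg k σ)) (BDeg k σ n))

instance (n : ℕ) : IsScalarTower k (Env k (AAlg k σ)) (BPiece k σ n) :=
  inferInstanceAs (IsScalarTower k (Env k (AAlg k σ)) (BDeg k σ n))

/-- The inclusion `B_n → B`. -/
def BPiece.val (n : ℕ) : BPiece k σ n →ₗ[Env k (AAlg k σ)] BAlg k σ := (BDeg k σ n).subtype

/-- The differential `d : B_{n+1} → B_n`. -/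
def BPiece.d (n : ℕ) : BPiece k σ (n + 1) →ₗ[Env k (AAlg k σ)] BPiece k σ n :=
  (dB k σ).restrict (dB_mem k σ n)

theorem BPiece.val_d (n : ℕ) (b : BPiece k σ (n + 1)) :
    BPiece.val k σ n (BPiece.d k σ n b) = dB k σ (BPiece.val k σ (n + 1) b) := rfl

/-- The element `1` of `B_0`. -/
def BPiece.one : BPiece k σ 0 :=
  ⟨1, Submodule.subset_span ⟨[], by simp, by simp [word]⟩⟩

/-- The element `e_x` of `B_1`. -/
def BPiece.e (x : X) : BPiece k σ 1 :=
  ⟨BAlg.gen k σ (.e x), Submodule.subset_span ⟨[.e x], by simp [Gen.deg], by simp [word]⟩⟩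

variable (M : Type*) [AddCommGroup M] [Module k M] [Module (Env k (AAlg k σ)) M]
  [IsScalarTower k (Env k (AAlg k σ)) M]

/-- Yang–Baxter homology `H^{YB}_n(X, M)`: the homology of `M ⊗_{A'-A} B`. -/
abbrev HYB (n : ℕ) : Type _ := Homology (C := BPiece k σ) (BPiece.d k σ) M n

/-- Yang–Baxter cohomology `H_{YB}^n(X, M)`: the cohomology of `Hom_{A'-A}(B, M)`. -/
abbrev HYBco (n : ℕ) : Type _ := Cohomology (C := BPiece k σ) (BPiece.d k σ) M n

/-- Hochschild homology `H_n(A, M)`: the homology of `M ⊗_{Aᵉ} (A ⊗ A^{⊗ n} ⊗ A, b')`. -/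
abbrev HH (n : ℕ) : Type _ :=
  Homology (C := Bar k (AAlg k σ)) (Bar.d k (AAlg k σ)) M n

/-- Hochschild cohomology `H^n(A, M)`: the cohomology of `Hom_{Aᵉ}((A ⊗ A^{⊗ n} ⊗ A, b'), M)`. -/
abbrev HHco (n : ℕ) : Type _ :=
  Cohomology (C := Bar k (AAlg k σ)) (Bar.d k (AAlg k σ)) M n

section coeff

variable {M}
variable {M' : Type*} [AddCommGroup M'] [Module k M'] [Module (Env k (AAlg k σ)) M']
  [IsScalarTower k (Env k (AAlg k σ)) M'] (f : M →ₗ[Env k (AAlg k σ)] M') (n : ℕ)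

/-- `H^{YB}_n(X, f)`. -/
abbrev HYB.map : HYB k σ M n →ₗ[k] HYB k σ M' n :=
  homologyCoeffMap (C := BPiece k σ) (BPiece.d k σ) f n

/-- `H_{YB}^n(X, f)`. -/
abbrev HYBco.map : HYBco k σ M n →ₗ[k] HYBco k σ M' n :=
  cohomologyCoeffMap (C := BPiece k σ) (BPiece.d k σ) f n

/-- `H_n(A, f)`. -/
abbrev HH.map : HH k σ M n →ₗ[k] HH k σ M' n :=
  homologyCoeffMap (C := Bar k (AAlg k σ)) (Bar.d k (AAlg k σ)) f n

/-- `H^n(A, f)`. -/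
abbrev HHco.map : HHco k σ M n →ₗ[k] HHco k σ M' n :=
  cohomologyCoeffMap (C := Bar k (AAlg k σ)) (Bar.d k (AAlg k σ)) f n

end coeff

end Solution

end YangBaxter

end

open YangBaxter

/-!
The idea is that `B` is a complex of free bimodules, so that the comparison with the standard
resolution exists, and that the two complexes have isomorphic bimodules in degree `0` and isomorphic
cokernels in degree `1`.

*Freeness.* Letters `x'` can be moved to the left and letters `x` to the right of any monomial of
`B`, so that `B_n` is generated as a bimodule by the words `e_{x_1} ⋯ e_{x_n}` (`BDeg_le_eSpan`).
Conversely, let `S` be the monoid with the same generators and relations as `A`. By the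
Yang–Baxter equation the generators of `B` act on the normal forms `s' e_l t`, that is, on
`S × List X × S`, compatibly with the defining relations (`normalFormHom`). Letting `b` act on the
normal form `1` and evaluating yields a bimodule map `B → N` with arbitrary prescribed values on the
words in the `e_x` (`freeLift`).

*Comparison map.* `comparison` is defined on these words, by `1 ↦ 1 ⊗ 1` and `e_x ↦ 1 ⊗ x ⊗ 1` in
degrees `0` and `1`, and recursively by `e_w ↦ -s (φ (d e_w))` in higher degrees, where
`s w = 1 ⊗ w` is the contracting homotopy of the standard resolution. From `b' s + s b' = id` and
`d d = 0` it follows that `b' φ = -φ d` (`d_comparison`).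

*Degrees `0` and `1`.* The map `B_0 → A ⊗ A` is an isomorphism. Since `d (e_x e_y)` is minus the
derivative of the relation `x y = z t`, the rule `x ↦ [e_x]` extends to a derivation of `A` with
values in `B_1 / d B_2`; it gives the inverse of the map from `B_1 / d B_2` to the cokernel of
`b' : A ⊗ A^{⊗ 2} ⊗ A → A ⊗ A ⊗ A`. Homology and cohomology in degrees `0` and `1` depend only on
the bimodules in degree `0`, on these cokernels, and on the differential between them, by right
exactness of `M ⊗_{Aᵉ} -` and left exactness of `Hom_{Aᵉ}(-, M)`; this is `IsLowDegreeIso` and its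
consequences.
-/

namespace YangBaxter

noncomputable section

set_option linter.unusedSectionVars false

/-! ### The enveloping algebra -/

section Env

variable {k A : Type*} [CommRing k] [Ring A] [Algebra k A]

theorem Env.tmul_smul_tmul_smul {N : Type*} [AddCommGroup N] [Module (Env k A) N]
    (a c a' c' : A) (n : N) :
    Env.tmul k a c • Env.tmul k a' c' • n = Env.tmul k (a * a') (c' * c) • n := by
  rw [smul_smul, Env.tmul_mul_tmul]

theorem Env.algebraMap_tmul (r : k) (c : A) :
    Env.tmul k (algebraMap k A r) c = r • Env.tmul k 1 c := by
  rw [Algebra.algebraMap_eq_smul_one]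
  exact TensorProduct.smul_tmul' r _ _

theorem Env.tmul_algebraMap (r : k) (a : A) :
    Env.tmul k a (algebraMap k A r) = r • Env.tmul k a 1 := by
  rw [Algebra.algebraMap_eq_smul_one]
  exact TensorProduct.tmul_smul r _ _

theorem Env.tmul_add (a b c : A) :
    Env.tmul k a (b + c) = Env.tmul k a b + Env.tmul k a c := TensorProduct.tmul_add _ _ _

theorem Env.add_tmul (a b c : A) :
    Env.tmul k (a + b) c = Env.tmul k a c + Env.tmul k b c := TensorProduct.add_tmul _ _ _

theorem Env.tmul_one_one : Env.tmul k (1 : A) 1 = 1 := rfl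

theorem Env.smul_tmul (r : k) (a c : A) : Env.tmul k (r • a) c = r • Env.tmul k a c :=
  TensorProduct.smul_tmul' r _ _

theorem Env.tmul_smul (r : k) (a c : A) : Env.tmul k a (r • c) = r • Env.tmul k a c :=
  TensorProduct.tmul_smul r _ _

end Env

/-! ### Comparison of two complexes of bimodules in degrees `0` and `1` -/

section Comparison

variable {k A : Type*} [CommRing k] [Ring A] [Algebra k A]

theorem BimodTensor.induction {M N : Type*} [AddCommGroup M] [Module k M] [Module (Env k A) M]
    [AddCommGroup N] [Module k N] [Module (Env k A) N] {P : BimodTensor k A M N → Prop}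
    (zero : P 0) (tmul : ∀ m n, P (bimodTmul k A m n)) (add : ∀ x y, P x → P y → P (x + y))
    (z : BimodTensor k A M N) : P z := by
  obtain ⟨z, rfl⟩ := Submodule.Quotient.mk_surjective _ z
  induction z using TensorProduct.induction_on with
  | zero => exact zero
  | tmul m n => exact tmul m n
  | add x y hx hy => exact add _ _ hx hy

section BimodMap

variable {M N N' N'' : Type*}
  [AddCommGroup M] [Module k M] [Module (Env k A) M]
  [AddCommGroup N] [Module k N] [Module (Env k A) N]
  [AddCommGroup N'] [Module k N'] [Module (Env k A) N']
  [AddCommGroup N''] [Module k N''] [Module (Env k A) N'']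

theorem bimodTmul_add (m : M) (n n' : N) :
    bimodTmul k A m (n + n') = bimodTmul k A m n + bimodTmul k A m n' :=
  congrArg Submodule.Quotient.mk (TensorProduct.tmul_add m n n')

theorem bimodTmul_neg (m : M) (n : N) : bimodTmul k A m (-n) = -bimodTmul k A m n :=
  congrArg Submodule.Quotient.mk (TensorProduct.tmul_neg m n)

theorem bimodTmul_zero (m : M) : bimodTmul k A m (0 : N) = 0 :=
  congrArg Submodule.Quotient.mk (TensorProduct.tmul_zero N m)

variable [IsScalarTower k (Env k A) M] [IsScalarTower k (Env k A) N]
  [IsScalarTower k (Env k A) N'] [IsScalarTower k (Env k A) N'']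

theorem bimodMap_comp (g : N' →ₗ[Env k A] N'') (f : N →ₗ[Env k A] N') (z : BimodTensor k A M N) :
    bimodMap LinearMap.id (g ∘ₗ f) z = bimodMap LinearMap.id g (bimodMap LinearMap.id f z) := by
  induction z using BimodTensor.induction with
  | zero => simp only [map_zero]
  | tmul m n => rfl
  | add x y hx hy => simp only [map_add, hx, hy]

theorem bimodMap_neg (f : N →ₗ[Env k A] N') (z : BimodTensor k A M N) :
    bimodMap LinearMap.id (-f) z = -bimodMap LinearMap.id f z := by
  induction z using BimodTensor.induction with
  | zero => simp only [map_zero, neg_zero]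
  | tmul m n => simp only [bimodMap_tmul, LinearMap.neg_apply, bimodTmul_neg]
  | add x y hx hy => rw [map_add, map_add, hx, hy, neg_add]

theorem bimodMap_zero (z : BimodTensor k A M N) :
    bimodMap LinearMap.id (0 : N →ₗ[Env k A] N') z = 0 := by
  induction z using BimodTensor.induction with
  | zero => simp only [map_zero]
  | tmul m n => simp only [bimodMap_tmul, LinearMap.zero_apply, bimodTmul_zero]
  | add x y hx hy => rw [map_add, hx, hy, add_zero]

theorem bimodMap_id (z : BimodTensor k A M N) :
    bimodMap LinearMap.id (LinearMap.id : N →ₗ[Env k A] N) z = z := by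
  induction z using BimodTensor.induction with
  | zero => simp only [map_zero]
  | tmul m n => rfl
  | add x y hx hy => rw [map_add, hx, hy]

theorem bimodMap_bijective {f : N →ₗ[Env k A] N'} (hf : Function.Bijective f) :
    Function.Bijective (bimodMap (LinearMap.id : M →ₗ[Env k A] M) f) := by
  set e := LinearEquiv.ofBijective f hf
  have h1 : (e.symm : N' →ₗ[Env k A] N) ∘ₗ f = LinearMap.id :=
    LinearMap.ext fun x => e.symm_apply_apply x
  have h2 : f ∘ₗ (e.symm : N' →ₗ[Env k A] N) = LinearMap.id :=
    LinearMap.ext fun x => e.apply_symm_apply x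
  refine Function.bijective_iff_has_inverse.2
    ⟨bimodMap LinearMap.id (e.symm : N' →ₗ[Env k A] N), fun z => ?_, fun z => ?_⟩
  · rw [← bimodMap_comp, h1, bimodMap_id]
  · rw [← bimodMap_comp, h2, bimodMap_id]

/-- Right exactness of `M ⊗_{Aᵉ} -`, in the form of an extension property: a bimodule map from `N'`
to the cokernel of `f : N'' → N` induces a map from `M ⊗ N'` to the cokernel of `M ⊗ f`. -/
theorem exists_tensor_coker_map (M : Type*) [AddCommGroup M] [Module k M] [Module (Env k A) M]
    [IsScalarTower k (Env k A) M] (f : N'' →ₗ[Env k A] N)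
    (θ : N' →ₗ[Env k A] N ⧸ LinearMap.range f) :
    ∃ T : BimodTensor k A M N' →ₗ[k] BimodTensor k A M N ⧸
        LinearMap.range (bimodMap (LinearMap.id : M →ₗ[Env k A] M) f),
      ∀ m n' n, θ n' = Submodule.Quotient.mk n →
        T (bimodTmul k A m n') = Submodule.Quotient.mk (bimodTmul k A m n) := by
  set R := LinearMap.range (bimodMap (LinearMap.id : M →ₗ[Env k A] M) f)
  -- For fixed `m`, the map `n ↦ [m ⊗ n]` kills the range of `f`, so it descends to the cokernel.
  let pair : M →ₗ[k] N →ₗ[k] BimodTensor k A M N ⧸ R :=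
    (TensorProduct.mk k M N).compr₂ (R.mkQ ∘ₗ (balancing k A M N).mkQ)
  have hpair : ∀ m n, pair m n = Submodule.Quotient.mk (bimodTmul k A m n) := fun _ _ => rfl
  have hker : ∀ m, (LinearMap.range f).restrictScalars k ≤ LinearMap.ker (pair m) := by
    rintro m _ ⟨y, rfl⟩
    rw [LinearMap.mem_ker, hpair]
    exact (Submodule.Quotient.mk_eq_zero _).2 ⟨bimodTmul k A m y, rfl⟩
  let lift : M →ₗ[k] (N ⧸ LinearMap.range f) →ₗ[k] BimodTensor k A M N ⧸ R :=
    { toFun := fun m => (((LinearMap.range f).restrictScalars k).liftQ (pair m) (hker m)) ∘ₗ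
        (LinearMap.id : (N ⧸ LinearMap.range f) →ₗ[k] (N ⧸ LinearMap.range f))
      map_add' := fun m m' => by
        refine LinearMap.ext fun q => ?_
        obtain ⟨n, rfl⟩ := Submodule.Quotient.mk_surjective _ q
        change pair (m + m') n = pair m n + pair m' n
        rw [map_add, LinearMap.add_apply]
      map_smul' := fun c m => by
        refine LinearMap.ext fun q => ?_
        obtain ⟨n, rfl⟩ := Submodule.Quotient.mk_surjective _ q
        change pair (c • m) n = c • pair m n
        rw [map_smul, LinearMap.smul_apply] }
  have hlift : ∀ m n, lift m (Submodule.Quotient.mk n) =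
      Submodule.Quotient.mk (bimodTmul k A m n) := fun _ _ => rfl
  let T₀ : M ⊗[k] N' →ₗ[k] BimodTensor k A M N ⧸ R :=
    TensorProduct.lift (lift.compl₂ (θ.restrictScalars k))
  have hT₀ : ∀ m n', T₀ (m ⊗ₜ n') = lift m (θ n') := fun m n' => by
    simp [T₀]
  have hbal : balancing k A M N' ≤ LinearMap.ker T₀ := by
    rw [balancing, Submodule.span_le]
    rintro z (⟨a, m, n', rfl⟩ | ⟨a, m, n', rfl⟩)
    all_goals
      rw [SetLike.mem_coe, LinearMap.mem_ker, map_sub, hT₀, hT₀, θ.map_smul]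
      obtain ⟨n, hn⟩ := Submodule.Quotient.mk_surjective _ (θ n')
      rw [← hn, ← Submodule.Quotient.mk_smul, hlift, hlift, ← Submodule.Quotient.mk_sub]
      refine congrArg Submodule.Quotient.mk (?_ : _ = (0 : BimodTensor k A M N))
      refine (Submodule.Quotient.mk_sub _).symm.trans ((Submodule.Quotient.mk_eq_zero _).2 ?_)
    · exact Submodule.subset_span (Or.inl ⟨a, m, n, rfl⟩)
    · exact Submodule.subset_span (Or.inr ⟨a, m, n, rfl⟩)
  refine ⟨(balancing k A M N').liftQ T₀ hbal, fun m n' n h => ?_⟩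
  change T₀ (m ⊗ₜ n') = _
  rw [hT₀, h, hlift]

end BimodMap

variable {C D : ℕ → Type*}
  [∀ n, AddCommGroup (C n)] [∀ n, Module k (C n)] [∀ n, Module (Env k A) (C n)]
  [∀ n, IsScalarTower k (Env k A) (C n)]
  [∀ n, AddCommGroup (D n)] [∀ n, Module k (D n)] [∀ n, Module (Env k A) (D n)]
  [∀ n, IsScalarTower k (Env k A) (D n)]
  {d : ∀ n, C (n + 1) →ₗ[Env k A] C n} {d' : ∀ n, D (n + 1) →ₗ[Env k A] D n}

/-- `φ` is a chain map from `(C, -d)` to `(D, d')`. -/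
def IsAntiChainMap (d : ∀ n, C (n + 1) →ₗ[Env k A] C n) (d' : ∀ n, D (n + 1) →ₗ[Env k A] D n)
    (φ : ∀ n, C n →ₗ[Env k A] D n) : Prop :=
  ∀ n, d' n ∘ₗ φ (n + 1) = -(φ n ∘ₗ d n)

variable {φ : ∀ n, C n →ₗ[Env k A] D n}
  (M : Type*) [AddCommGroup M] [Module k M] [Module (Env k A) M] [IsScalarTower k (Env k A) M]

variable {M} in
theorem IsAntiChainMap.tensor_d (hφ : IsAntiChainMap d d' φ) (n : ℕ)
    (z : BimodTensor k A M (C (n + 1))) :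
    bimodMap LinearMap.id (d' n) (bimodMap LinearMap.id (φ (n + 1)) z) =
      -bimodMap LinearMap.id (φ n) (bimodMap LinearMap.id (d n) z) := by
  rw [← bimodMap_comp, hφ, bimodMap_neg, bimodMap_comp]

theorem IsAntiChainMap.mem_cycles (hφ : IsAntiChainMap d d' φ) (n : ℕ) :
    ∀ z ∈ cycles d M n, bimodMap LinearMap.id (φ n) z ∈ cycles d' M n := by
  intro z hz
  cases n with
  | zero => trivial
  | succ n =>
    have hz' : bimodMap (LinearMap.id : M →ₗ[Env k A] M) (d n) z = 0 := hz
    change bimodMap LinearMap.id (d' n) _ = 0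
    rw [hφ.tensor_d, hz', map_zero, neg_zero]

/-- The map on homology with coefficients in `M` induced by `φ`. -/
def IsAntiChainMap.homologyMap (hφ : IsAntiChainMap d d' φ) (n : ℕ) :
    Homology d M n →ₗ[k] Homology d' M n :=
  Submodule.mapQ _ _
    ((bimodMap (LinearMap.id : M →ₗ[Env k A] M) (φ n)).restrict (hφ.mem_cycles M n)) <| by
      rintro ⟨z, hz⟩ ⟨y, hy⟩
      refine ⟨-bimodMap LinearMap.id (φ (n + 1)) y, ?_⟩
      rw [map_neg, hφ.tensor_d, hy, neg_neg]
      rfl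

theorem IsAntiChainMap.inducesHomology (hφ : IsAntiChainMap d d' φ) (n : ℕ) :
    InducesHomology (φ n) (hφ.homologyMap M n) :=
  fun z => ⟨hφ.mem_cycles M n _ z.2, rfl⟩

theorem IsAntiChainMap.mem_cocycles (hφ : IsAntiChainMap d d' φ) (n : ℕ)
    {g : D n →ₗ[Env k A] M} (hg : g ∈ cocycles d' M n) : g ∘ₗ φ n ∈ cocycles d M n := by
  have hg' : g ∘ₗ d' n = 0 := hg
  change (g ∘ₗ φ n) ∘ₗ d n = 0
  rw [LinearMap.comp_assoc, ← neg_neg (φ n ∘ₗ d n), ← hφ n, LinearMap.comp_neg,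
    ← LinearMap.comp_assoc, hg', LinearMap.zero_comp, neg_zero]

/-- The map on cohomology with coefficients in `M` induced by `φ`. -/
def IsAntiChainMap.cohomologyMap (hφ : IsAntiChainMap d d' φ) (n : ℕ) :
    Cohomology d' M n →ₗ[k] Cohomology d M n :=
  Submodule.mapQ _ _
    { toFun := fun g => ⟨g.1 ∘ₗ φ n, hφ.mem_cocycles M n g.2⟩
      map_add' := fun _ _ => rfl
      map_smul' := fun _ _ => rfl } <| by
      rintro ⟨g, hg⟩ hgb
      cases n with
      | zero =>
        have h0 : g = 0 := hgb
        subst h0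
        change (0 : D 0 →ₗ[Env k A] M) ∘ₗ φ 0 = 0
        rw [LinearMap.zero_comp]
      | succ n =>
        obtain ⟨h, hh⟩ := hgb
        refine ⟨-(h ∘ₗ φ n), ?_⟩
        have hh' : h ∘ₗ d' n = g := hh
        change (-(h ∘ₗ φ n)) ∘ₗ d n = g ∘ₗ φ (n + 1)
        rw [← hh', LinearMap.comp_assoc, hφ n, LinearMap.comp_neg, LinearMap.neg_comp,
          LinearMap.comp_assoc]

theorem IsAntiChainMap.inducesCohomology (hφ : IsAntiChainMap d d' φ) (n : ℕ) :
    InducesCohomology (φ n) (hφ.cohomologyMap M n) :=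
  fun g => ⟨hφ.mem_cocycles M n g.2, rfl⟩

variable {M} in
theorem IsAntiChainMap.homologyMap_natural (hφ : IsAntiChainMap d d' φ)
    {M' : Type*} [AddCommGroup M'] [Module k M'] [Module (Env k A) M']
    [IsScalarTower k (Env k A) M'] (f : M →ₗ[Env k A] M') (n : ℕ) (h : Homology d M n) :
    hφ.homologyMap M' n (homologyCoeffMap d f n h) =
      homologyCoeffMap d' f n (hφ.homologyMap M n h) := by
  obtain ⟨z, rfl⟩ := Submodule.Quotient.mk_surjective _ h
  exact congrArg Submodule.Quotient.mk (Subtype.ext (bimodMap_comm f (φ n) z.1).symm)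

variable {M} in
theorem IsAntiChainMap.cohomologyMap_natural (hφ : IsAntiChainMap d d' φ)
    {M' : Type*} [AddCommGroup M'] [Module k M'] [Module (Env k A) M']
    [IsScalarTower k (Env k A) M'] (f : M →ₗ[Env k A] M') (n : ℕ) (h : Cohomology d' M n) :
    hφ.cohomologyMap M' n (cohomologyCoeffMap d' f n h) =
      cohomologyCoeffMap d f n (hφ.cohomologyMap M n h) := by
  obtain ⟨z, rfl⟩ := Submodule.Quotient.mk_surjective _ h
  rfl

/-- Conditions on `φ` that force the induced maps in degrees `0` and `1` to be bijective: `φ 0` is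
bijective, and `φ 1` induces an isomorphism `coker (d 1) ≅ coker (d' 1)`. The inverse of the latter
is given as a bimodule map `θ` on `D 1`; surjectivity is the field `exists_eq`. -/
structure IsLowDegreeIso (d : ∀ n, C (n + 1) →ₗ[Env k A] C n)
    (d' : ∀ n, D (n + 1) →ₗ[Env k A] D n) (φ : ∀ n, C n →ₗ[Env k A] D n)
    (θ : D 1 →ₗ[Env k A] C 1 ⧸ LinearMap.range (d 1)) : Prop where
  anti : IsAntiChainMap d d' φ
  d_comp_d : d' 0 ∘ₗ d' 1 = 0
  bijective_zero : Function.Bijective (φ 0)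
  θ_comp_d : θ ∘ₗ d' 1 = 0
  θ_comp_φ : θ ∘ₗ φ 1 = (LinearMap.range (d 1)).mkQ
  exists_eq : ∀ w : D 1, ∃ b v, w = φ 1 b + d' 1 v

variable {θ : D 1 →ₗ[Env k A] C 1 ⧸ LinearMap.range (d 1)}

variable {M} in
/-- Surjectivity onto the cokernel of `d' 1`, after tensoring with `M`. -/
theorem IsLowDegreeIso.exists_eq_tensor (h : IsLowDegreeIso d d' φ θ)
    (z : BimodTensor k A M (D 1)) :
    ∃ u y, z = bimodMap LinearMap.id (φ 1) u + bimodMap LinearMap.id (d' 1) y := by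
  induction z using BimodTensor.induction with
  | zero => exact ⟨0, 0, by simp only [map_zero, add_zero]⟩
  | tmul m w =>
    obtain ⟨b, v, rfl⟩ := h.exists_eq w
    exact ⟨bimodTmul k A m b, bimodTmul k A m v, by simp only [bimodMap_tmul, bimodTmul_add]; rfl⟩
  | add x y hx hy =>
    obtain ⟨u, v, rfl⟩ := hx
    obtain ⟨u', v', rfl⟩ := hy
    exact ⟨u + u', v + v', by simp only [map_add]; abel⟩

variable {M} in
theorem IsLowDegreeIso.tensor_d_d (h : IsLowDegreeIso d d' φ θ) (y : BimodTensor k A M (D 2)) :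
    bimodMap LinearMap.id (d' 0) (bimodMap LinearMap.id (d' 1) y) = 0 := by
  rw [← bimodMap_comp, h.d_comp_d, bimodMap_zero]

theorem IsLowDegreeIso.homologyMap_zero_bijective (h : IsLowDegreeIso d d' φ θ) :
    Function.Bijective (h.anti.homologyMap M 0) := by
  have hb := bimodMap_bijective (M := M) h.bijective_zero
  constructor
  · rw [injective_iff_map_eq_zero]
    intro q hq
    obtain ⟨⟨z, hz⟩, rfl⟩ := Submodule.Quotient.mk_surjective _ q
    obtain ⟨y, hy⟩ := (Submodule.Quotient.mk_eq_zero _).1 hq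
    obtain ⟨u, v, rfl⟩ := h.exists_eq_tensor y
    rw [map_add, h.tensor_d_d, add_zero, h.anti.tensor_d, ← map_neg] at hy
    refine (Submodule.Quotient.mk_eq_zero _).2 ⟨-u, ?_⟩
    rw [map_neg]
    exact hb.1 hy
  · intro q
    obtain ⟨⟨z, hz⟩, rfl⟩ := Submodule.Quotient.mk_surjective _ q
    obtain ⟨y, rfl⟩ := hb.2 z
    exact ⟨Submodule.Quotient.mk ⟨y, trivial⟩, rfl⟩

theorem IsLowDegreeIso.homologyMap_one_bijective (h : IsLowDegreeIso d d' φ θ) :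
    Function.Bijective (h.anti.homologyMap M 1) := by
  have hb := bimodMap_bijective (M := M) h.bijective_zero
  constructor
  · rw [injective_iff_map_eq_zero]
    intro q hq
    obtain ⟨⟨z, hz⟩, rfl⟩ := Submodule.Quotient.mk_surjective _ q
    obtain ⟨y, hy⟩ := (Submodule.Quotient.mk_eq_zero _).1 hq
    -- `T` is a left inverse of `M ⊗ φ 1` modulo boundaries, and it kills the boundaries.
    obtain ⟨T, hT⟩ := exists_tensor_coker_map M (d 1) θ
    have hTφ : ∀ z, T (bimodMap LinearMap.id (φ 1) z) = Submodule.Quotient.mk z := fun z => by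
      induction z using BimodTensor.induction with
      | zero => simp only [map_zero, Submodule.Quotient.mk_zero]
      | tmul m b => exact hT m _ b (LinearMap.congr_fun h.θ_comp_φ b)
      | add x y hx hy => simp only [map_add, hx, hy, Submodule.Quotient.mk_add]
    have hTd : ∀ y, T (bimodMap LinearMap.id (d' 1) y) = 0 := fun y => by
      induction y using BimodTensor.induction with
      | zero => simp only [map_zero]
      | tmul m b =>
        rw [bimodMap_tmul, hT _ _ 0 (LinearMap.congr_fun h.θ_comp_d b), bimodTmul_zero,
          Submodule.Quotient.mk_zero]
      | add x y hx hy => simp only [map_add, hx, hy, add_zero]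
    refine (Submodule.Quotient.mk_eq_zero _).2
      ((Submodule.Quotient.mk_eq_zero (boundaries d M 1)).1 ?_)
    exact (hTφ z).symm.trans ((congrArg T hy).symm.trans (hTd y))
  · intro q
    obtain ⟨⟨z, hz⟩, rfl⟩ := Submodule.Quotient.mk_surjective _ q
    obtain ⟨u, y, rfl⟩ := h.exists_eq_tensor z
    have hz' : bimodMap (LinearMap.id : M →ₗ[Env k A] M) (d' 0) _ = 0 := hz
    rw [map_add, h.tensor_d_d, add_zero, h.anti.tensor_d, neg_eq_zero] at hz'
    have hu : u ∈ cycles d M 1 := hb.1 (hz'.trans (map_zero _).symm)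
    refine ⟨Submodule.Quotient.mk ⟨u, hu⟩, ?_⟩
    refine ((Submodule.Quotient.eq _).2 ⟨-y, ?_⟩)
    rw [map_neg]
    exact (sub_add_cancel_left _ _).symm

theorem IsLowDegreeIso.cohomologyMap_zero_bijective (h : IsLowDegreeIso d d' φ θ) :
    Function.Bijective (h.anti.cohomologyMap M 0) := by
  constructor
  · rw [injective_iff_map_eq_zero]
    intro q hq
    obtain ⟨⟨g, hg⟩, rfl⟩ := Submodule.Quotient.mk_surjective _ q
    have hq' : g ∘ₗ φ 0 = 0 := (Submodule.Quotient.mk_eq_zero _).1 hq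
    refine (Submodule.Quotient.mk_eq_zero _).2 (?_ : g = 0)
    refine LinearMap.ext fun w => ?_
    obtain ⟨b, rfl⟩ := h.bijective_zero.2 w
    exact LinearMap.congr_fun hq' b
  · intro q
    obtain ⟨⟨g, hg⟩, rfl⟩ := Submodule.Quotient.mk_surjective _ q
    have hg' : g ∘ₗ d 0 = 0 := hg
    let e := LinearEquiv.ofBijective (φ 0) h.bijective_zero
    have he : ∀ b, e.symm (φ 0 b) = b := e.symm_apply_apply
    have hc : (g ∘ₗ (e.symm : D 0 →ₗ[Env k A] C 0)) ∈ cocycles d' M 0 := by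
      refine LinearMap.ext fun w => ?_
      obtain ⟨b, v, rfl⟩ := h.exists_eq w
      have h1 : d' 0 (φ 1 b) = -φ 0 (d 0 b) := LinearMap.congr_fun (h.anti 0) b
      have h2 : d' 0 (d' 1 v) = 0 := LinearMap.congr_fun h.d_comp_d v
      change g (e.symm (d' 0 (φ 1 b + d' 1 v))) = 0
      rw [map_add, h1, h2, add_zero, map_neg, he, map_neg, neg_eq_zero]
      exact LinearMap.congr_fun hg' b
    refine ⟨Submodule.Quotient.mk ⟨_, hc⟩, congrArg Submodule.Quotient.mk (Subtype.ext ?_)⟩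
    exact LinearMap.ext fun b => congrArg g (he b)

theorem IsLowDegreeIso.cohomologyMap_one_bijective (h : IsLowDegreeIso d d' φ θ) :
    Function.Bijective (h.anti.cohomologyMap M 1) := by
  constructor
  · rw [injective_iff_map_eq_zero]
    intro q hq
    obtain ⟨⟨g, hg⟩, rfl⟩ := Submodule.Quotient.mk_surjective _ q
    obtain ⟨f, hf⟩ := (Submodule.Quotient.mk_eq_zero _).1 hq
    have hg' : g ∘ₗ d' 1 = 0 := hg
    have hf' : f ∘ₗ d 0 = g ∘ₗ φ 1 := hf
    let e := LinearEquiv.ofBijective (φ 0) h.bijective_zero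
    have he : ∀ b, e.symm (φ 0 b) = b := e.symm_apply_apply
    refine (Submodule.Quotient.mk_eq_zero _).2
      ⟨-(f ∘ₗ (e.symm : D 0 →ₗ[Env k A] C 0)), LinearMap.ext fun w => ?_⟩
    obtain ⟨b, v, rfl⟩ := h.exists_eq w
    have h1 : d' 0 (φ 1 b) = -φ 0 (d 0 b) := LinearMap.congr_fun (h.anti 0) b
    have h2 : d' 0 (d' 1 v) = 0 := LinearMap.congr_fun h.d_comp_d v
    have h3 : g (d' 1 v) = 0 := LinearMap.congr_fun hg' v
    change -f (e.symm (d' 0 (φ 1 b + d' 1 v))) = g (φ 1 b + d' 1 v)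
    rw [map_add, map_add g, h1, h2, h3, add_zero, add_zero, map_neg, he, map_neg, neg_neg]
    exact LinearMap.congr_fun hf' b
  · intro q
    obtain ⟨⟨g, hg⟩, rfl⟩ := Submodule.Quotient.mk_surjective _ q
    have hg' : g ∘ₗ d 1 = 0 := hg
    let g' := (LinearMap.range (d 1)).liftQ g (LinearMap.range_le_ker_iff.2 hg')
    have hc : g' ∘ₗ θ ∈ cocycles d' M 1 := by
      change (g' ∘ₗ θ) ∘ₗ d' 1 = 0
      rw [LinearMap.comp_assoc, h.θ_comp_d, LinearMap.comp_zero]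
    refine ⟨Submodule.Quotient.mk ⟨_, hc⟩, congrArg Submodule.Quotient.mk (Subtype.ext ?_)⟩
    change (g' ∘ₗ θ) ∘ₗ φ 1 = g
    rw [LinearMap.comp_assoc, h.θ_comp_φ, Submodule.liftQ_mkQ]

end Comparison

/-! ### Letters passing through words and through the structure monoid -/

section Pass

variable {X : Type*} (σ : X × X ≃ X × X)

/-- The Yang–Baxter equation evaluated at `(x, y, a)`, in components. -/
theorem IsSolution.apply {σ : X × X ≃ X × X} (hσ : IsSolution σ) (x y a : X) :
    (σ ((σ (x, y)).1, (σ ((σ (x, y)).2, a)).1)).1 = (σ (x, (σ (y, a)).1)).1 ∧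
    ((σ ((σ (x, y)).1, (σ ((σ (x, y)).2, a)).1)).2, (σ ((σ (x, y)).2, a)).2) =
      σ ((σ (x, (σ (y, a)).1)).2, (σ (y, a)).2) := by
  have h := congrFun hσ (x, y, a)
  simp only [Function.comp_apply, Prod.mk.injEq] at h
  exact ⟨h.1.symm, h.2.symm⟩

/-- Passing a letter `x` from the left to the right of a word by successive applications of `σ`:
the resulting word, and the letter that comes out on the right. -/
def passWord : X → List X → List X × X
  | x, [] => ([], x)
  | x, y :: l =>
    ((σ (x, y)).1 :: (passWord (σ (x, y)).2 l).1, (passWord (σ (x, y)).2 l).2)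

theorem passWord_length (x : X) (l : List X) : (passWord σ x l).1.length = l.length := by
  induction l generalizing x with
  | nil => rfl
  | cons y l ih => simp [passWord, ih]

variable {σ} in
/-- Passing `x` and `y` through a word commutes with applying `σ` to the pair. -/
theorem passWord_passWord (hσ : IsSolution σ) (x y : X) (l : List X) :
    (passWord σ (σ (x, y)).1 (passWord σ (σ (x, y)).2 l).1).1 =
      (passWord σ x (passWord σ y l).1).1 ∧
    ((passWord σ (σ (x, y)).1 (passWord σ (σ (x, y)).2 l).1).2,
        (passWord σ (σ (x, y)).2 l).2) =
      σ ((passWord σ x (passWord σ y l).1).2, (passWord σ y l).2) := by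
  induction l generalizing x y with
  | nil => exact ⟨rfl, rfl⟩
  | cons a l ih =>
    obtain ⟨h1, h2⟩ := hσ.apply x y a
    obtain ⟨h2a, h2b⟩ := Prod.ext_iff.1 h2
    dsimp only at h2a h2b
    simp only [passWord]
    rw [h1, h2a, h2b]
    obtain ⟨i1, i2⟩ := ih (σ (x, (σ (y, a)).1)).2 (σ (y, a)).2
    exact ⟨by rw [i1], i2⟩

/-- The defining relations of the structure monoid. -/
def structureRel : FreeMonoid X → FreeMonoid X → Prop := fun a b =>
  ∃ x y, a = .of x * .of y ∧ b = .of (σ (x, y)).1 * .of (σ (x, y)).2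

/-- The structure monoid `⟨X | x y = z t for σ (x, y) = (z, t)⟩`. -/
abbrev StructureMonoid : Type _ := PresentedMonoid (structureRel σ)

/-- The generator `x` of the structure monoid. -/
def StructureMonoid.of (x : X) : StructureMonoid σ := PresentedMonoid.of (structureRel σ) x

theorem StructureMonoid.of_mul_of (x y : X) :
    of σ x * of σ y = of σ (σ (x, y)).1 * of σ (σ (x, y)).2 :=
  PresentedMonoid.mk_eq_mk_of_rel ⟨x, y, rfl, rfl⟩

variable {σ} in
theorem StructureMonoid.induction {P : StructureMonoid σ → Prop} (one : P 1)
    (of_mul : ∀ x s, P s → P (of σ x * s)) (s : StructureMonoid σ) : P s := by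
  obtain ⟨l, rfl⟩ := PresentedMonoid.surjective_mk s
  induction l using FreeMonoid.inductionOn' with
  | one => exact one
  | of_mul x l ih => exact of_mul x _ ih

variable {σ} (hσ : IsSolution σ)

/-- The right action of the structure monoid on pairs (element, letter), in which a generator `y`
sends `(s, x)` to `(s z, t)` for `σ (x, y) = (z, t)`. -/
def StructureMonoid.passHom :
    StructureMonoid σ →* (Function.End (StructureMonoid σ × X))ᵐᵒᵖ :=
  PresentedMonoid.lift (M := (Function.End (StructureMonoid σ × X))ᵐᵒᵖ)
    (fun y => MulOpposite.op fun p => (p.1 * of σ (σ (p.2, y)).1, (σ (p.2, y)).2)) <| by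
      rintro _ _ ⟨y, a, rfl, rfl⟩
      simp only [map_mul, FreeMonoid.lift_eval_of]
      refine congrArg MulOpposite.op (funext fun ⟨s, x⟩ => ?_)
      obtain ⟨h1, h2⟩ := hσ.apply x y a
      obtain ⟨h2a, h2b⟩ := Prod.ext_iff.1 h2
      refine Prod.ext ?_ h2b
      change s * of σ (σ (x, y)).1 * of σ (σ ((σ (x, y)).2, a)).1 =
        s * of σ (σ (x, (σ (y, a)).1)).1 * of σ (σ ((σ (x, (σ (y, a)).1)).2, (σ (y, a)).2)).1
      rw [mul_assoc, mul_assoc, of_mul_of, h1, ← h2a]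

/-- Passing a letter `x` from the left to the right of an element `s` of the structure monoid: the
resulting element, and the letter that comes out on the right. -/
def StructureMonoid.pass (x : X) (s : StructureMonoid σ) : StructureMonoid σ × X :=
  (passHom hσ s).unop (1, x)

/-- The action on pairs commutes with left multiplication by `r`. -/
theorem StructureMonoid.passHom_apply (s r : StructureMonoid σ) (x : X) :
    (passHom hσ s).unop (r, x) = (r * (pass hσ x s).1, (pass hσ x s).2) := by
  unfold pass
  induction s using StructureMonoid.induction generalizing r x with
  | one => rw [map_one]; exact Prod.ext (mul_one r).symm rfl
  | of_mul y s ih =>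
    have h : ∀ r, (passHom hσ (of σ y * s)).unop (r, x) =
        (passHom hσ s).unop (r * of σ (σ (x, y)).1, (σ (x, y)).2) := fun r => by
      rw [map_mul]; rfl
    rw [h, h, ih, ih (1 * _), one_mul, mul_assoc]

theorem StructureMonoid.pass_one (x : X) : pass hσ x 1 = (1, x) := by
  rw [pass, map_one]; rfl

theorem StructureMonoid.pass_of_mul (x y : X) (s : StructureMonoid σ) :
    pass hσ x (of σ y * s) =
      (of σ (σ (x, y)).1 * (pass hσ (σ (x, y)).2 s).1, (pass hσ (σ (x, y)).2 s).2) := by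
  rw [← passHom_apply]
  unfold pass
  rw [map_mul]
  change (passHom hσ s).unop (1 * of σ (σ (x, y)).1, (σ (x, y)).2) = _
  rw [one_mul]

/-- Passing `x` and `y` through an element of the structure monoid commutes with applying `σ` to the
pair. -/
theorem StructureMonoid.pass_pass (x y : X) (s : StructureMonoid σ) :
    (pass hσ (σ (x, y)).1 (pass hσ (σ (x, y)).2 s).1).1 = (pass hσ x (pass hσ y s).1).1 ∧
    ((pass hσ (σ (x, y)).1 (pass hσ (σ (x, y)).2 s).1).2, (pass hσ (σ (x, y)).2 s).2) =
      σ ((pass hσ x (pass hσ y s).1).2, (pass hσ y s).2) := by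
  induction s using StructureMonoid.induction generalizing x y with
  | one => simp only [pass_one, and_self]
  | of_mul a s ih =>
    obtain ⟨h1, h2⟩ := hσ.apply x y a
    obtain ⟨h2a, h2b⟩ := Prod.ext_iff.1 h2
    dsimp only at h2a h2b
    simp only [pass_of_mul]
    rw [h1, h2a, h2b]
    obtain ⟨i1, i2⟩ := ih (σ (x, (σ (y, a)).1)).2 (σ (y, a)).2
    exact ⟨by rw [i1], i2⟩

end Pass

/-! ### `B` is a free bimodule on the words in the letters `e_x` -/

section Free

variable (k : Type u) [CommRing k] {X : Type*} {σ : X × X ≃ X × X}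

/-- The normal forms of monomials in `B`: the triple `(s, l, t)` stands for `s' e_l t`. -/
abbrev NormalForm (σ : X × X ≃ X × X) : Type _ :=
  StructureMonoid σ × List X × StructureMonoid σ

/-- Left multiplication by a generator of `B` on normal forms. The letter `x'` joins `s`; the letter
`e_x` passes `s` and joins `l`; the letter `x` passes `s` and `l` and joins `t`. -/
def genAct (hσ : IsSolution σ) : Gen X → NormalForm σ → NormalForm σ
  | .x' x, (s, l, t) => (.of σ x * s, l, t)
  | .e x, (s, l, t) =>
    ((StructureMonoid.pass hσ x s).1, (StructureMonoid.pass hσ x s).2 :: l, t)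
  | .x x, (s, l, t) =>
    ((StructureMonoid.pass hσ x s).1, (passWord σ (StructureMonoid.pass hσ x s).2 l).1,
      .of σ (passWord σ (StructureMonoid.pass hσ x s).2 l).2 * t)

/-- The action of `B` on the free `k`-module on the normal forms. -/
def normalFormHom (hσ : IsSolution σ) : BAlg k σ →ₐ[k] Module.End k (NormalForm σ →₀ k) :=
  BAlg.lift k σ (fun g => Finsupp.lmapDomain k k (genAct hσ g)) <| by
    -- Each relation of `B` can be checked on the normal forms.
    have key : ∀ g₁ g₂ g₃ g₄ : Gen X,
        (∀ p, genAct hσ g₁ (genAct hσ g₂ p) = genAct hσ g₃ (genAct hσ g₄ p)) →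
        (Finsupp.lmapDomain k k (genAct hσ g₁) * Finsupp.lmapDomain k k (genAct hσ g₂) :
          Module.End k (NormalForm σ →₀ k)) =
        Finsupp.lmapDomain k k (genAct hσ g₃) * Finsupp.lmapDomain k k (genAct hσ g₄) := by
      intro g₁ g₂ g₃ g₄ h
      rw [Module.End.mul_eq_comp, Module.End.mul_eq_comp, ← Finsupp.lmapDomain_comp,
        ← Finsupp.lmapDomain_comp]
      exact congrArg _ (funext h)
    constructor <;> intro x y <;> apply key <;> rintro ⟨s, l, t⟩ <;> simp only [genAct]
    · obtain ⟨h1, h2⟩ := StructureMonoid.pass_pass hσ x y s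
      obtain ⟨h2a, h2b⟩ := Prod.ext_iff.1 h2
      dsimp only at h2a h2b
      rw [h1, h2a, h2b]
      set x₁ := (StructureMonoid.pass hσ x (StructureMonoid.pass hσ y s).1).2
      set y₁ := (StructureMonoid.pass hσ y s).2
      obtain ⟨i1, i2⟩ := passWord_passWord hσ x₁ y₁ l
      obtain ⟨i2a, i2b⟩ := Prod.ext_iff.1 i2
      dsimp only at i2a i2b
      rw [i1, i2a, i2b, ← mul_assoc, ← mul_assoc, StructureMonoid.of_mul_of]
    · rw [StructureMonoid.pass_of_mul]
    · rw [← mul_assoc, ← mul_assoc, StructureMonoid.of_mul_of]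
    · obtain ⟨h1, h2⟩ := StructureMonoid.pass_pass hσ x y s
      obtain ⟨h2a, h2b⟩ := Prod.ext_iff.1 h2
      dsimp only at h2a h2b
      rw [h1, h2a, h2b]
      rfl
    · rw [StructureMonoid.pass_of_mul]

theorem normalFormHom_gen_single (hσ : IsSolution σ) (g : Gen X) (p : NormalForm σ) (c : k) :
    normalFormHom k hσ (BAlg.gen k σ g) (Finsupp.single p c) =
      Finsupp.single (genAct hσ g p) c := by
  rw [normalFormHom, BAlg.lift_gen, Finsupp.lmapDomain_apply, Finsupp.mapDomain_single]

theorem AAlg.x_mul_x (x y : X) :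
    AAlg.x k σ x * AAlg.x k σ y = AAlg.x k σ (σ (x, y)).1 * AAlg.x k σ (σ (x, y)).2 := by
  simp only [AAlg.x]
  rw [← map_mul, ← map_mul]
  exact RingQuot.mkAlgHom_rel k (ARel.xy x y)

variable (σ) in
/-- The monoid map from the structure monoid to the algebra `A`. -/
def StructureMonoid.toAAlg : StructureMonoid σ →* AAlg k σ :=
  PresentedMonoid.lift (AAlg.x k σ) <| by
    rintro _ _ ⟨x, y, rfl, rfl⟩
    simp only [map_mul, FreeMonoid.lift_eval_of]
    exact AAlg.x_mul_x k x y

variable (σ) in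
theorem StructureMonoid.toAAlg_of (x : X) :
    StructureMonoid.toAAlg k σ (.of σ x) = AAlg.x k σ x :=
  PresentedMonoid.lift_of _ _

variable {k}
variable {N : Type*} [AddCommGroup N] [Module k N] [Module (Env k (AAlg k σ)) N]
  [IsScalarTower k (Env k (AAlg k σ)) N]

/-- The linear map `(s, l, t) ↦ s · f l · t` on the normal forms. -/
def normalFormEval (f : List X → N) : (NormalForm σ →₀ k) →ₗ[k] N :=
  Finsupp.linearCombination k fun p : NormalForm σ =>
    Env.tmul k (StructureMonoid.toAAlg k σ p.1) (StructureMonoid.toAAlg k σ p.2.2) • f p.2.1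

theorem normalFormEval_single (f : List X → N) (p : NormalForm σ) (c : k) :
    normalFormEval f (Finsupp.single p c) =
      c • Env.tmul k (StructureMonoid.toAAlg k σ p.1) (StructureMonoid.toAAlg k σ p.2.2) •
        f p.2.1 :=
  Finsupp.linearCombination_single k c p

theorem normalFormEval_x' (hσ : IsSolution σ) (f : List X → N) (x : X) (p : NormalForm σ →₀ k) :
    normalFormEval f (normalFormHom k hσ (BAlg.gen k σ (.x' x)) p) =
      Env.tmul k (AAlg.x k σ x) 1 • normalFormEval f p := by
  induction p using Finsupp.induction_linear with
  | zero => simp only [map_zero, smul_zero]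
  | add p q hp hq => simp only [map_add, smul_add, hp, hq]
  | single p c =>
    rw [normalFormHom_gen_single, normalFormEval_single, normalFormEval_single, smul_comm _ c,
      Env.tmul_smul_tmul_smul, mul_one, ← StructureMonoid.toAAlg_of, ← map_mul]
    rfl

/-- Right multiplication by a letter on the normal forms. -/
def rightMul (x : X) : (NormalForm σ →₀ k) →ₗ[k] (NormalForm σ →₀ k) :=
  Finsupp.lmapDomain k k fun p => (p.1, p.2.1, p.2.2 * .of σ x)

theorem rightMul_single (x : X) (p : NormalForm σ) (c : k) :
    rightMul x (Finsupp.single p c) = Finsupp.single (p.1, p.2.1, p.2.2 * .of σ x) c := by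
  rw [rightMul, Finsupp.lmapDomain_apply, Finsupp.mapDomain_single]

theorem normalFormEval_rightMul (f : List X → N) (x : X) (p : NormalForm σ →₀ k) :
    normalFormEval f (rightMul x p) = Env.tmul k 1 (AAlg.x k σ x) • normalFormEval f p := by
  induction p using Finsupp.induction_linear with
  | zero => simp only [map_zero, smul_zero]
  | add p q hp hq => simp only [map_add, smul_add, hp, hq]
  | single p c =>
    rw [rightMul_single, normalFormEval_single, normalFormEval_single, smul_comm _ c,
      Env.tmul_smul_tmul_smul, one_mul, ← StructureMonoid.toAAlg_of, ← map_mul]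

theorem normalFormHom_rightMul (hσ : IsSolution σ) (b : BAlg k σ) (x : X)
    (p : NormalForm σ →₀ k) :
    normalFormHom k hσ b (rightMul x p) = rightMul x (normalFormHom k hσ b p) := by
  induction b using BAlg.induction k σ generalizing p with
  | scalar r =>
    rw [AlgHom.commutes, Module.algebraMap_end_apply, Module.algebraMap_end_apply, map_smul]
  | mul a b ha hb => rw [map_mul, Module.End.mul_apply, Module.End.mul_apply, hb, ha]
  | add a b ha hb => rw [map_add, LinearMap.add_apply, LinearMap.add_apply, ha, hb, map_add]
  | gen g =>
    induction p using Finsupp.induction_linear with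
    | zero => simp only [map_zero]
    | add p q hp hq => simp only [map_add, hp, hq]
    | single p c =>
      rw [rightMul_single, normalFormHom_gen_single, normalFormHom_gen_single, rightMul_single]
      obtain ⟨s, l, t⟩ := p
      cases g <;> simp only [genAct, mul_assoc]

/-- Act with `b` on the normal form `1`, and evaluate the result with `f` on the words in the
letters `e_x`. -/
def freeLiftLin (hσ : IsSolution σ) (f : List X → N) : BAlg k σ →ₗ[k] N :=
  normalFormEval f ∘ₗ
    (LinearMap.applyₗ (Finsupp.single ((1, [], 1) : NormalForm σ) (1 : k))) ∘ₗ
      (normalFormHom k hσ).toLinearMap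

theorem freeLiftLin_apply (hσ : IsSolution σ) (f : List X → N) (b : BAlg k σ) :
    freeLiftLin hσ f b =
      normalFormEval f (normalFormHom k hσ b (Finsupp.single (1, [], 1) 1)) := rfl

theorem freeLiftLin_incl'_mul (hσ : IsSolution σ) (f : List X → N) (a : AAlg k σ)
    (b : BAlg k σ) :
    freeLiftLin hσ f (incl' k σ a * b) = Env.tmul k a 1 • freeLiftLin hσ f b := by
  induction a using AAlg.induction k σ generalizing b with
  | scalar r =>
    rw [AlgHom.commutes, ← Algebra.smul_def, map_smul, Env.algebraMap_tmul, Env.tmul_one_one,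
      smul_assoc, one_smul]
  | gen x =>
    rw [incl'_x, freeLiftLin_apply, map_mul, Module.End.mul_apply, normalFormEval_x']
    rfl
  | mul a c ha hc => rw [map_mul (incl' k σ), mul_assoc, ha, hc, Env.tmul_smul_tmul_smul, mul_one]
  | add a c ha hc => rw [map_add, add_mul, map_add, ha, hc, Env.add_tmul, add_smul]

theorem freeLiftLin_mul_incl (hσ : IsSolution σ) (f : List X → N) (c : AAlg k σ)
    (b : BAlg k σ) :
    freeLiftLin hσ f (b * incl k σ c) = Env.tmul k 1 c • freeLiftLin hσ f b := by
  induction c using AAlg.induction k σ generalizing b with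
  | scalar r =>
    rw [AlgHom.commutes, ← Algebra.commutes, ← Algebra.smul_def, map_smul, Env.tmul_algebraMap,
      Env.tmul_one_one, smul_assoc, one_smul]
  | gen x =>
    have h : normalFormHom k hσ (BAlg.gen k σ (.x x)) (Finsupp.single (1, [], 1) 1) =
        rightMul x (Finsupp.single (1, [], 1) 1) := by
      rw [normalFormHom_gen_single, rightMul_single]
      simp only [genAct, StructureMonoid.pass_one, passWord, mul_one, one_mul]
    rw [incl_x, freeLiftLin_apply, map_mul, Module.End.mul_apply, h, normalFormHom_rightMul,
      normalFormEval_rightMul]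
    rfl
  | mul a c ha hc => rw [map_mul (incl k σ), ← mul_assoc, hc, ha, Env.tmul_smul_tmul_smul, mul_one]
  | add a c ha hc => rw [map_add, mul_add, map_add, ha, hc, Env.tmul_add, add_smul]

/-- The bimodule map `B → N` with prescribed values `f` on the words in the letters `e_x`. It exists
because, by the Yang–Baxter equation, these words are a basis of the bimodule `B`. -/
def freeLift (hσ : IsSolution σ) (f : List X → N) : BAlg k σ →ₗ[Env k (AAlg k σ)] N where
  toFun := freeLiftLin hσ f
  map_add' := map_add _
  map_smul' e b := by
    rw [RingHom.id_apply]
    induction e using Env.induction with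
    | zero => rw [zero_smul, zero_smul, map_zero]
    | add x y hx hy => rw [add_smul, map_add, hx, hy, add_smul]
    | tmul a c =>
      rw [BAlg.tmul_smul, freeLiftLin_mul_incl, freeLiftLin_incl'_mul, Env.tmul_smul_tmul_smul,
        one_mul, one_mul]

variable (k σ) in
/-- The word `e_{x_1} ⋯ e_{x_n}` in `B`. -/
def eWord (l : List X) : BAlg k σ := word k σ (l.map Gen.e)

variable (k σ) in
theorem eWord_cons (x : X) (l : List X) :
    eWord k σ (x :: l) = BAlg.gen k σ (.e x) * eWord k σ l := by
  simp [eWord, word]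

theorem eWord_mem (l : List X) : eWord k σ l ∈ BDeg k σ l.length := by
  have h := word_mem k σ (l.map Gen.e)
  rwa [List.map_map, show Gen.deg ∘ Gen.e = fun _ : X => 1 from rfl, List.map_const',
    List.sum_replicate, smul_eq_mul, mul_one] at h

theorem freeLift_eWord (hσ : IsSolution σ) (f : List X → N) (l : List X) :
    freeLift hσ f (eWord k σ l) = f l := by
  have h : normalFormHom k hσ (eWord k σ l) (Finsupp.single (1, [], 1) 1) =
      Finsupp.single (1, l, 1) 1 := by
    induction l with
    | nil => simp [eWord, word]
    | cons x l ih =>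
      rw [eWord_cons, map_mul, Module.End.mul_apply, ih, normalFormHom_gen_single]
      simp only [genAct, StructureMonoid.pass_one]
  change normalFormEval f (normalFormHom k hσ (eWord k σ l) (Finsupp.single (1, [], 1) 1)) = _
  rw [h, normalFormEval_single, map_one, Env.tmul_one_one, one_smul, one_smul]

/-- A letter `x` or `e_x` moves to the right of the letters `y'`. -/
theorem gen_mul_incl'_mem (c : X → Gen X)
    (hc : ∀ x y, BAlg.gen k σ (c x) * BAlg.gen k σ (.x' y) =
      BAlg.gen k σ (.x' (σ (x, y)).1) * BAlg.gen k σ (c (σ (x, y)).2))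
    (a : AAlg k σ) (x : X) :
    BAlg.gen k σ (c x) * incl' k σ a ∈
      Submodule.span k {b | ∃ a' y, b = incl' k σ a' * BAlg.gen k σ (c y)} := by
  induction a using AAlg.induction k σ generalizing x with
  | scalar r =>
    exact Submodule.subset_span ⟨algebraMap k _ r, x, by
      rw [AlgHom.commutes, Algebra.commutes]⟩
  | gen y => exact Submodule.subset_span ⟨AAlg.x k σ (σ (x, y)).1, (σ (x, y)).2, by
      rw [incl'_x, incl'_x, hc]⟩
  | add a b ha hb => rw [map_add, mul_add]; exact add_mem (ha x) (hb x)
  | mul a b ha hb =>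
    rw [map_mul, ← mul_assoc]
    have h := ha x
    generalize BAlg.gen k σ (c x) * incl' k σ a = p at h
    induction h using Submodule.span_induction with
    | zero => rw [zero_mul]; exact zero_mem _
    | add p q _ _ hp hq => rw [add_mul]; exact add_mem hp hq
    | smul r p _ hp => rw [smul_mul_assoc]; exact Submodule.smul_mem _ _ hp
    | mem p hp =>
      obtain ⟨a', y, rfl⟩ := hp
      rw [mul_assoc]
      have h := hb y
      generalize BAlg.gen k σ (c y) * incl' k σ b = q at h
      induction h using Submodule.span_induction with
      | zero => rw [mul_zero]; exact zero_mem _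
      | add p q _ _ hp hq => rw [mul_add]; exact add_mem hp hq
      | smul r p _ hp => rw [mul_smul_comm]; exact Submodule.smul_mem _ _ hp
      | mem q hq =>
        obtain ⟨b', z, rfl⟩ := hq
        exact Submodule.subset_span ⟨a' * b', z, by rw [map_mul, mul_assoc]⟩

/-- A letter `x` moves to the right of the letters `e_y`. -/
theorem gen_x_mul_eWord (x : X) (l : List X) :
    BAlg.gen k σ (.x x) * eWord k σ l =
      eWord k σ (passWord σ x l).1 * BAlg.gen k σ (.x (passWord σ x l).2) := by
  induction l generalizing x with
  | nil => simp [eWord, word, passWord]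
  | cons y l ih =>
    simp only [passWord]
    rw [eWord_cons, eWord_cons, ← mul_assoc, (BAlg.gen_compat k σ).xe, mul_assoc, ih, mul_assoc]

variable (k σ) in
/-- The sub-bimodule of `B` generated by the words of length `n` in the letters `e_x`. -/
def eSpan (n : ℕ) : Submodule (Env k (AAlg k σ)) (BAlg k σ) :=
  Submodule.span _ {b | ∃ l : List X, l.length = n ∧ b = eWord k σ l}

theorem eSpan_smul_mem {n : ℕ} (a c : AAlg k σ) {b : BAlg k σ} (hb : b ∈ eSpan k σ n) :
    incl' k σ a * b * incl k σ c ∈ eSpan k σ n := by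
  rw [← BAlg.tmul_smul]
  exact Submodule.smul_mem _ _ hb

theorem incl'_mul_mem_eSpan {n : ℕ} (a : AAlg k σ) {b : BAlg k σ} (hb : b ∈ eSpan k σ n) :
    incl' k σ a * b ∈ eSpan k σ n := by
  have h := eSpan_smul_mem a 1 hb
  rwa [map_one, mul_one] at h

/-- Left multiplication by a generator preserves the spans of the words in the letters `e_x`: the
letters `x` and `e_x` are moved past the letters `y'`, and `x` then past the word. -/
theorem gen_mul_mem_eSpan (g : Gen X) {n m : ℕ} (hm : m = g.deg + n) {b : BAlg k σ}
    (hb : b ∈ eSpan k σ n) : BAlg.gen k σ g * b ∈ eSpan k σ m := by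
  subst hm
  -- It suffices to treat `c x * (a' e_l)` for a letter `c x` that passes the letters `y'`.
  have key : ∀ (c : X → Gen X) (m : ℕ) (x : X),
      (∀ x y, BAlg.gen k σ (c x) * BAlg.gen k σ (.x' y) =
        BAlg.gen k σ (.x' (σ (x, y)).1) * BAlg.gen k σ (c (σ (x, y)).2)) →
      (∀ y l, l.length = n → BAlg.gen k σ (c y) * eWord k σ l ∈ eSpan k σ m) →
      BAlg.gen k σ (c x) * b ∈ eSpan k σ m := by
    intro c m x hc hl
    induction hb using Submodule.closure_induction with
    | zero => rw [mul_zero]; exact zero_mem _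
    | add p q _ _ hp hq => rw [mul_add]; exact add_mem hp hq
    | smul_mem r p hp =>
      obtain ⟨l, hlen, rfl⟩ := hp
      induction r using Env.induction with
      | zero => rw [zero_smul, mul_zero]; exact zero_mem _
      | add p q hp hq => rw [add_smul, mul_add]; exact add_mem hp hq
      | tmul a b =>
        rw [BAlg.tmul_smul, ← mul_assoc, ← mul_assoc]
        have h := gen_mul_incl'_mem c hc a x
        generalize BAlg.gen k σ (c x) * incl' k σ a = q at h
        induction h using Submodule.span_induction with
        | zero => rw [zero_mul, zero_mul]; exact zero_mem _
        | add p q _ _ hp hq => rw [add_mul, add_mul]; exact add_mem hp hq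
        | smul r p _ hp =>
          rw [smul_mul_assoc, smul_mul_assoc]
          exact ((eSpan k σ m).restrictScalars k).smul_mem r hp
        | mem q hq =>
          obtain ⟨a', y, rfl⟩ := hq
          rw [mul_assoc (incl' k σ a')]
          exact eSpan_smul_mem _ _ (hl y l hlen)
  cases g with
  | x' x =>
    rw [← incl'_x, show (Gen.x' x).deg + n = n from zero_add n]
    exact incl'_mul_mem_eSpan _ hb
  | x x =>
    refine key Gen.x _ x (BAlg.gen_compat k σ).xx' fun y l hl => ?_
    rw [gen_x_mul_eWord, ← incl_x, show (Gen.x x).deg + n = n from zero_add n]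
    have h := eSpan_smul_mem 1 (AAlg.x k σ (passWord σ y l).2)
      (Submodule.subset_span ⟨_, (passWord_length σ y l).trans hl, rfl⟩)
    rwa [map_one, one_mul] at h
  | e x =>
    refine key Gen.e _ x (BAlg.gen_compat k σ).ex' fun y l hl => ?_
    rw [← eWord_cons]
    exact Submodule.subset_span ⟨y :: l, by rw [List.length_cons, hl, add_comm]; rfl, rfl⟩

variable (k σ) in
theorem BDeg_le_eSpan (n : ℕ) : BDeg k σ n ≤ eSpan k σ n := by
  have hw : ∀ l : List (Gen X), word k σ l ∈ eSpan k σ (l.map Gen.deg).sum := by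
    intro l
    induction l with
    | nil => exact Submodule.subset_span ⟨[], rfl, rfl⟩
    | cons g l ih =>
      have h : word k σ (g :: l) = BAlg.gen k σ g * word k σ l := by simp [word]
      rw [h]
      exact gen_mul_mem_eSpan g (by simp) ih
  have h : wordSpan k σ n ≤ (eSpan k σ n).restrictScalars k := by
    refine Submodule.span_le.2 ?_
    rintro _ ⟨l, rfl, rfl⟩
    exact hw l
  exact fun b hb => h hb

/-- Bimodule maps on `B_n` that agree on the words of length `n` in the letters `e_x` are equal. -/
theorem BPiece.hom_ext {n : ℕ} {f g : BPiece k σ n →ₗ[Env k (AAlg k σ)] N}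
    (h : ∀ (b : BPiece k σ n) (l : List X), l.length = n → BPiece.val k σ n b = eWord k σ l →
      f b = g b) : f = g := by
  have hle : eSpan k σ n ≤ (LinearMap.eqLocus f g).map (BPiece.val k σ n) := by
    refine Submodule.span_le.2 ?_
    rintro _ ⟨l, rfl, rfl⟩
    exact ⟨⟨eWord k σ l, eWord_mem l⟩, h _ l rfl rfl, rfl⟩
  refine LinearMap.ext fun b => ?_
  obtain ⟨b', hb', hval⟩ := hle (BDeg_le_eSpan k σ n b.2)
  obtain rfl : b' = b := Subtype.ext hval
  exact hb'

/-- Bimodule maps on `B` that agree on the words of length `n` in the letters `e_x` agree on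
`B_n`. -/
theorem eq_on_BDeg {n : ℕ} {f g : BAlg k σ →ₗ[Env k (AAlg k σ)] N}
    (h : ∀ l : List X, l.length = n → f (eWord k σ l) = g (eWord k σ l)) {b : BAlg k σ}
    (hb : b ∈ BDeg k σ n) : f b = g b :=
  LinearMap.congr_fun (BPiece.hom_ext (f := f ∘ₗ BPiece.val k σ n) (g := g ∘ₗ BPiece.val k σ n)
    fun b l hl hb => by rw [LinearMap.comp_apply, LinearMap.comp_apply, hb, h l hl]) ⟨b, hb⟩

end Free

/-! ### The standard resolution: contracting homotopy and low degrees -/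

section BarResolution

variable {k : Type*} {A : Type*} [CommRing k] [Ring A] [Algebra k A]

theorem Bar.hom_ext {n : ℕ} {N : Type*} [AddCommMonoid N] [Module k N]
    {f g : Bar k A n →ₗ[k] N} (h : ∀ v, f (Bar.tprod k A v) = g (Bar.tprod k A v)) : f = g :=
  PiTensorProduct.ext (MultilinearMap.ext h)

/-- The contracting homotopy `a_0 ⊗ ⋯ ⊗ a_{n+1} ↦ 1 ⊗ a_0 ⊗ ⋯ ⊗ a_{n+1}`. -/
def Bar.homotopy (n : ℕ) : Bar k A n →ₗ[k] Bar k A (n + 1) :=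
  PiTensorProduct.lift
    ((PiTensorProduct.tprod k : MultilinearMap k (fun _ : Fin (n + 3) => A) _).curryLeft 1)

theorem Bar.homotopy_tprod {n : ℕ} (v : Fin (n + 2) → A) :
    Bar.homotopy n (Bar.tprod k A v) =
      Bar.tprod k A (Fin.cons 1 v : Fin (n + 3) → A) :=
  PiTensorProduct.lift.tprod _

theorem Bar.face_zero_homotopy {n : ℕ} (w : Bar k A n) :
    Bar.face n 0 (Bar.homotopy n w) = w := by
  have h : Bar.face n 0 ∘ₗ Bar.homotopy (k := k) (A := A) n = LinearMap.id := by
    refine Bar.hom_ext fun v => ?_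
    rw [LinearMap.comp_apply, Bar.homotopy_tprod, Bar.face_tprod, LinearMap.id_apply]
    congr 1
    funext i
    refine Fin.cases ?_ (fun i => ?_) i
    · simp [Fin.contractNth]
    · simp [Fin.contractNth]
  exact LinearMap.congr_fun h w

theorem Bar.face_succ_homotopy {n : ℕ} (j : Fin (n + 2)) (w : Bar k A (n + 1)) :
    Bar.face (n + 1) j.succ (Bar.homotopy (n + 1) w) = Bar.homotopy n (Bar.face n j w) := by
  have h : Bar.face (n + 1) j.succ ∘ₗ Bar.homotopy (k := k) (A := A) (n + 1) =
      Bar.homotopy n ∘ₗ Bar.face n j := by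
    refine Bar.hom_ext fun v => ?_
    rw [LinearMap.comp_apply, Bar.homotopy_tprod, Bar.face_tprod, LinearMap.comp_apply,
      Bar.face_tprod, Bar.homotopy_tprod]
    congr 1
    funext i
    refine Fin.cases ?_ (fun i => ?_) i
    · simp [Fin.contractNth]
    · simp [Fin.contractNth, Fin.castSucc_succ]
  exact LinearMap.congr_fun h w

theorem Bar.d_apply {n : ℕ} (w : Bar k A (n + 1)) :
    Bar.d k A n w = ∑ j : Fin (n + 2), (-1 : k) ^ (j : ℕ) • Bar.face n j w := rfl

/-- The homotopy identity `b' s = id - s b'` in positive degrees. -/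
theorem Bar.d_homotopy {n : ℕ} (w : Bar k A (n + 1)) :
    Bar.d k A (n + 1) (Bar.homotopy (n + 1) w) = w - Bar.homotopy n (Bar.d k A n w) := by
  rw [Bar.d_apply, Fin.sum_univ_succ, Bar.face_zero_homotopy, Bar.d_apply, map_sum,
    sub_eq_add_neg, ← Finset.sum_neg_distrib]
  simp only [Bar.face_succ_homotopy, Fin.val_zero, pow_zero, one_smul, Fin.val_succ, pow_succ,
    mul_neg, mul_one, neg_smul, map_smul]

theorem Bar.d_zero_tprod (v : Fin 3 → A) :
    Bar.d k A 0 (Bar.tprod k A v) =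
      Bar.tprod k A ![v 0 * v 1, v 2] - Bar.tprod k A ![v 0, v 1 * v 2] := by
  rw [Bar.d_apply, Fin.sum_univ_two, Bar.face_tprod, Bar.face_tprod]
  simp only [Fin.val_zero, pow_zero, one_smul, Fin.val_one, pow_one, neg_smul, sub_eq_add_neg]
  congr 3 <;> funext i <;> fin_cases i <;> simp [Fin.contractNth]

theorem Bar.d_one_tprod (v : Fin 4 → A) :
    Bar.d k A 1 (Bar.tprod k A v) =
      Bar.tprod k A ![v 0 * v 1, v 2, v 3] - Bar.tprod k A ![v 0, v 1 * v 2, v 3] +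
        Bar.tprod k A ![v 0, v 1, v 2 * v 3] := by
  rw [Bar.d_apply, Fin.sum_univ_three, Bar.face_tprod, Bar.face_tprod, Bar.face_tprod]
  simp only [Fin.val_zero, pow_zero, one_smul, Fin.val_one, pow_one, neg_smul, sub_eq_add_neg,
    Fin.val_two, neg_one_sq]
  congr 3 <;> (try congr 1) <;> funext i <;> fin_cases i <;> simp [Fin.contractNth]

theorem Bar.d_zero_comp_d_one : Bar.d k A 0 ∘ₗ Bar.d k A 1 = 0 := by
  have h : (Bar.d k A 0 ∘ₗ Bar.d k A 1).restrictScalars k = 0 := by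
    refine Bar.hom_ext fun v => ?_
    change Bar.d k A 0 (Bar.d k A 1 (Bar.tprod k A v)) = 0
    rw [Bar.d_one_tprod, map_add, map_sub, Bar.d_zero_tprod, Bar.d_zero_tprod, Bar.d_zero_tprod]
    simp [mul_assoc]
  exact LinearMap.ext fun w => LinearMap.congr_fun h w

theorem Bar.tmul_smul_zero (a c : A) (v : Fin 2 → A) :
    Env.tmul k a c • Bar.tprod k A v = Bar.tprod k A ![a * v 0, v 1 * c] := by
  rw [Bar.tmul_smul]
  congr 1
  funext i
  fin_cases i <;> rfl

theorem Bar.tmul_smul_one (a c : A) (v : Fin 3 → A) :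
    Env.tmul k a c • Bar.tprod k A v = Bar.tprod k A ![a * v 0, v 1, v 2 * c] := by
  rw [Bar.tmul_smul]
  congr 1
  funext i
  fin_cases i <;> rfl

variable {N : Type*} [AddCommGroup N] [Module k N] [Module (Env k A) N]
  [IsScalarTower k (Env k A) N]

/-- A `k`-linear map on `Bar k A n` that commutes with the action of pure tensors is a bimodule
map. -/
def Bar.homMk {n : ℕ} (f : Bar k A n →ₗ[k] N)
    (hf : ∀ (a c : A) v,
      f (Env.tmul k a c • Bar.tprod k A v) = Env.tmul k a c • f (Bar.tprod k A v)) :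
    Bar k A n →ₗ[Env k A] N where
  toFun := f
  map_add' := map_add f
  map_smul' e w := by
    rw [RingHom.id_apply]
    induction e using Env.induction with
    | zero => rw [zero_smul, zero_smul, map_zero]
    | add x y hx hy => rw [add_smul, map_add, hx, hy, add_smul]
    | tmul a c =>
      induction w using PiTensorProduct.induction_on with
      | add x y hx hy => rw [smul_add, map_add, hx, hy, map_add, smul_add]
      | smul_tprod r v =>
        rw [smul_comm _ r, f.map_smul r, f.map_smul r, smul_comm _ r]
        exact congrArg (r • ·) (hf a c v)

/-- The bimodule map `A ⊗ A → N` with value `n` at `1 ⊗ 1`. -/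
def Bar.liftZero (n : N) : Bar k A 0 →ₗ[Env k A] N :=
  Bar.homMk (PiTensorProduct.lift
    { toFun := fun v => Env.tmul k (v 0) (v 1) • n
      map_update_add' := by
        intro inst v i a b
        obtain rfl := Subsingleton.elim inst (instDecidableEqFin _)
        fin_cases i <;> simp [Env.add_tmul, Env.tmul_add, add_smul]
      map_update_smul' := by
        intro inst v i r a
        obtain rfl := Subsingleton.elim inst (instDecidableEqFin _)
        fin_cases i <;> simp [Env.smul_tmul, Env.tmul_smul, smul_assoc] }) <| by
    intro a c v
    rw [Bar.tmul_smul_zero]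
    refine (PiTensorProduct.lift.tprod _).trans
      (Eq.trans ?_ (congrArg (_ • ·) (PiTensorProduct.lift.tprod _).symm))
    exact (Env.tmul_smul_tmul_smul _ _ _ _ _).symm

theorem Bar.liftZero_tprod (n : N) (v : Fin 2 → A) :
    Bar.liftZero n (Bar.tprod k A v) = Env.tmul k (v 0) (v 1) • n :=
  PiTensorProduct.lift.tprod _

/-- The multilinear map `(a, b, c) ↦ a · D b · c`. -/
def Bar.liftOneMultilinear (D : A →ₗ[k] N) : MultilinearMap k (fun _ : Fin 3 => A) N where
  toFun v := Env.tmul k (v 0) (v 2) • D (v 1)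
  map_update_add' := by
    intro inst v i a b
    obtain rfl := Subsingleton.elim inst (instDecidableEqFin _)
    fin_cases i <;> simp [Env.add_tmul, Env.tmul_add, add_smul, smul_add]
  map_update_smul' := by
    intro inst v i r a
    obtain rfl := Subsingleton.elim inst (instDecidableEqFin _)
    fin_cases i <;> simp [Env.smul_tmul, Env.tmul_smul, smul_assoc, smul_comm r]

/-- The bimodule map `A ⊗ A ⊗ A → N` with value `D b` at `1 ⊗ b ⊗ 1`. -/
def Bar.liftOne (D : A →ₗ[k] N) : Bar k A 1 →ₗ[Env k A] N :=
  Bar.homMk (PiTensorProduct.lift (Bar.liftOneMultilinear D)) <| by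
    intro a c v
    rw [Bar.tmul_smul_one]
    refine (PiTensorProduct.lift.tprod _).trans
      (Eq.trans ?_ (congrArg (_ • ·) (PiTensorProduct.lift.tprod _).symm))
    exact (Env.tmul_smul_tmul_smul _ _ _ _ _).symm

theorem Bar.liftOne_tprod (D : A →ₗ[k] N) (v : Fin 3 → A) :
    Bar.liftOne D (Bar.tprod k A v) = Env.tmul k (v 0) (v 2) • D (v 1) :=
  PiTensorProduct.lift.tprod _

/-- The map `A ⊗ A ⊗ A → N` given by a derivation vanishes on boundaries. -/
theorem Bar.liftOne_comp_d {D : A →ₗ[k] N}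
    (hD : ∀ a b, D (a * b) = Env.tmul k a 1 • D b + Env.tmul k 1 b • D a) :
    Bar.liftOne D ∘ₗ Bar.d k A 1 = 0 := by
  have h : (Bar.liftOne D ∘ₗ Bar.d k A 1).restrictScalars k = 0 := by
    refine Bar.hom_ext fun v => ?_
    change Bar.liftOne D (Bar.d k A 1 (Bar.tprod k A v)) = 0
    rw [Bar.d_one_tprod, map_add, map_sub, Bar.liftOne_tprod, Bar.liftOne_tprod,
      Bar.liftOne_tprod]
    simp [hD, Env.tmul_smul_tmul_smul, smul_add]
  exact LinearMap.ext fun w => LinearMap.congr_fun h w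

end BarResolution

/-! ### Derivations on `A` -/

section Derivation

variable {k : Type u} [CommRing k] {X : Type*} {σ : X × X ≃ X × X}
  {N : Type*} [AddCommGroup N] [Module k N] [Module (Env k (AAlg k σ)) N]
  [IsScalarTower k (Env k (AAlg k σ)) N]

variable (σ) in
/-- The operator `(b, q) ↦ (x b, x q + n b)` on `A × N`. -/
def derivStep (n : N) (x : X) : Module.End k (AAlg k σ × N) where
  toFun p := (AAlg.x k σ x * p.1, Env.tmul k (AAlg.x k σ x) 1 • p.2 + Env.tmul k 1 p.1 • n)
  map_add' p q := by
    refine Prod.ext (mul_add _ _ _) ?_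
    simp only [Prod.fst_add, Prod.snd_add, smul_add, Env.tmul_add, add_smul]
    abel
  map_smul' r p := by
    refine Prod.ext (mul_smul_comm _ _ _) ?_
    simp only [Prod.smul_fst, Prod.smul_snd, Env.tmul_smul, smul_assoc, smul_add,
      RingHom.id_apply, smul_comm _ r]

/-- Values on the generators that respect the derivatives of the relations extend to a derivation
on `A`. The derivation is read off from a representation of `A` on `A × N` by triangular
operators. -/
theorem exists_derivation (g : X → N)
    (hg : ∀ x y, Env.tmul k (AAlg.x k σ x) 1 • g y + Env.tmul k 1 (AAlg.x k σ y) • g x =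
      Env.tmul k (AAlg.x k σ (σ (x, y)).1) 1 • g (σ (x, y)).2 +
        Env.tmul k 1 (AAlg.x k σ (σ (x, y)).2) • g (σ (x, y)).1) :
    ∃ D : AAlg k σ →ₗ[k] N, (∀ x, D (AAlg.x k σ x) = g x) ∧
      ∀ a b, D (a * b) = Env.tmul k a 1 • D b + Env.tmul k 1 b • D a := by
  have hstep : ∀ x y (p : AAlg k σ × N), derivStep σ (g x) x (derivStep σ (g y) y p) =
      (AAlg.x k σ x * AAlg.x k σ y * p.1, Env.tmul k (AAlg.x k σ x * AAlg.x k σ y) 1 • p.2 +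
        Env.tmul k 1 p.1 • (Env.tmul k (AAlg.x k σ x) 1 • g y +
          Env.tmul k 1 (AAlg.x k σ y) • g x)) := fun x y p => by
    refine Prod.ext (mul_assoc _ _ _).symm ?_
    change Env.tmul k (AAlg.x k σ x) 1 • (Env.tmul k (AAlg.x k σ y) 1 • p.2 +
      Env.tmul k 1 p.1 • g y) + Env.tmul k 1 (AAlg.x k σ y * p.1) • g x = _
    simp only [smul_add, Env.tmul_smul_tmul_smul, mul_one, one_mul, add_assoc]
  let E : AAlg k σ →ₐ[k] Module.End k (AAlg k σ × N) :=
    AAlg.lift k σ (fun x => derivStep σ (g x) x) fun x y => by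
      refine LinearMap.ext fun p => ?_
      rw [Module.End.mul_apply, Module.End.mul_apply, hstep, hstep, hg, AAlg.x_mul_x]
  let D : AAlg k σ →ₗ[k] N :=
    LinearMap.snd k (AAlg k σ) N ∘ₗ LinearMap.applyₗ ((1, 0) : AAlg k σ × N) ∘ₗ E.toLinearMap
  have hD : ∀ a, D a = (E a (1, 0)).2 := fun _ => rfl
  have hx : ∀ x, E (AAlg.x k σ x) = derivStep σ (g x) x := AAlg.lift_x k σ _ _
  have hE : ∀ a b q, E a (b, q) = (a * b, Env.tmul k a 1 • q + Env.tmul k 1 b • D a) := by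
    intro a
    induction a using AAlg.induction k σ with
    | scalar r =>
      intro b q
      rw [hD, AlgHom.commutes, Module.algebraMap_end_apply, Module.algebraMap_end_apply]
      refine Prod.ext (Algebra.smul_def r b) ?_
      simp [Env.algebraMap_tmul, Env.tmul_one_one]
    | gen x =>
      intro b q
      rw [hD, hx]
      simp [derivStep, Env.tmul_one_one]
    | mul a c ha hc =>
      intro b q
      rw [hD, map_mul, Module.End.mul_apply, Module.End.mul_apply, hc, hc, ha, ha]
      refine Prod.ext (mul_assoc _ _ _).symm ?_
      simp only [smul_add, Env.tmul_smul_tmul_smul, smul_zero, zero_add, mul_one, one_mul,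
        add_assoc]
    | add a c ha hc =>
      intro b q
      rw [map_add, LinearMap.add_apply, ha, hc, map_add]
      refine Prod.ext (add_mul _ _ _).symm ?_
      simp only [Prod.snd_add, Env.add_tmul, add_smul, smul_add]
      abel
  refine ⟨D, fun x => ?_, fun a b => ?_⟩
  · rw [hD, hx]
    simp [derivStep, Env.tmul_one_one]
  · rw [hD (a * b), map_mul, Module.End.mul_apply, hE b, hE a]
    simp [Env.tmul_one_one]

end Derivation

/-! ### The comparison map from `B` to the standard resolution -/

section ComparisonMap

variable {k : Type u} [CommRing k] {X : Type v} {σ : X × X ≃ X × X}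

theorem sign_sign (b : BAlg k σ) : sign k σ (sign k σ b) = b := by
  induction b using BAlg.induction k σ with
  | scalar r => rw [AlgHom.commutes, AlgHom.commutes]
  | gen g => cases g <;> simp [sign_gen, Gen.deg]
  | mul a b ha hb => rw [map_mul, map_mul, ha, hb]
  | add a b ha hb => rw [map_add, map_add, ha, hb]

theorem sign_dLin (b : BAlg k σ) : sign k σ (dLin k σ b) = -dLin k σ (sign k σ b) := by
  induction b using BAlg.induction k σ with
  | scalar r => rw [AlgHom.commutes, dLin_algebraMap, map_zero, neg_zero]
  | gen g => cases g <;> simp [sign_gen, Gen.deg, dLin_gen, dGen]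
  | mul a b ha hb =>
    simp only [dLin_mul, map_mul, map_add, ha, hb, sign_sign, neg_mul, mul_neg, neg_add]
  | add a b ha hb => rw [map_add, map_add, ha, hb, map_add, map_add, neg_add]

theorem dLin_dLin (b : BAlg k σ) : dLin k σ (dLin k σ b) = 0 := by
  induction b using BAlg.induction k σ with
  | scalar r => rw [dLin_algebraMap, map_zero]
  | gen g => cases g <;> simp [dLin_gen, dGen]
  | mul a b ha hb => simp [dLin_mul, ha, hb, sign_dLin, sign_sign]
  | add a b ha hb => rw [map_add, map_add, ha, hb, add_zero]

/-- The comparison map from `B` to the standard resolution. Its values on the words in the letters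
`e_x` are prescribed in degrees `0` and `1`, and are obtained from the contracting homotopy of the
standard resolution in higher degrees. Only its restriction to `B_n` matters. -/
def comparison (hσ : IsSolution σ) : ∀ n, BAlg k σ →ₗ[Env k (AAlg k σ)] Bar k (AAlg k σ) n
  | 0 => freeLift hσ fun _ => Bar.tprod k (AAlg k σ) ![1, 1]
  | 1 => freeLift hσ fun
    | [x] => Bar.tprod k (AAlg k σ) ![1, AAlg.x k σ x, 1]
    | _ => 0
  | n + 2 => freeLift hσ fun l =>
    -Bar.homotopy (n + 1) (comparison hσ (n + 1) (dB k σ (eWord k σ l)))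

theorem eWord_nil : eWord k σ [] = 1 := rfl

theorem eWord_singleton (x : X) : eWord k σ [x] = BAlg.gen k σ (.e x) := by
  rw [eWord_cons, eWord_nil, mul_one]

theorem comparison_zero_one (hσ : IsSolution σ) :
    comparison hσ 0 (1 : BAlg k σ) = Bar.tprod k (AAlg k σ) ![1, 1] := by
  rw [← eWord_nil, comparison, freeLift_eWord]

theorem comparison_one_e (hσ : IsSolution σ) (x : X) :
    comparison hσ 1 (BAlg.gen k σ (.e x)) = Bar.tprod k (AAlg k σ) ![1, AAlg.x k σ x, 1] := by
  rw [← eWord_singleton, comparison, freeLift_eWord]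

theorem d_comparison (hσ : IsSolution σ) (n : ℕ) {b : BAlg k σ} (hb : b ∈ BDeg k σ (n + 1)) :
    Bar.d k (AAlg k σ) n (comparison hσ (n + 1) b) = -comparison hσ n (dB k σ b) := by
  induction n generalizing b with
  | zero =>
    refine eq_on_BDeg (f := Bar.d k (AAlg k σ) 0 ∘ₗ comparison hσ 1)
      (g := -(comparison hσ 0 ∘ₗ dB k σ)) (fun l hl => ?_) hb
    obtain ⟨x, rfl⟩ := List.length_eq_one_iff.1 hl
    have hd : dB k σ (BAlg.gen k σ (.e x)) =
        Env.tmul k 1 (AAlg.x k σ x) • (1 : BAlg k σ) -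
          Env.tmul k (AAlg.x k σ x) 1 • (1 : BAlg k σ) := by
      rw [BAlg.tmul_smul, BAlg.tmul_smul, incl_x, incl'_x, map_one, map_one, one_mul, one_mul,
        mul_one, mul_one]
      exact dLin_gen k σ _
    rw [eWord_singleton]
    change Bar.d k (AAlg k σ) 0 (comparison hσ 1 (BAlg.gen k σ (.e x))) =
      -comparison hσ 0 (dB k σ (BAlg.gen k σ (.e x)))
    rw [hd, comparison_one_e, map_sub, LinearMap.map_smul, LinearMap.map_smul,
      comparison_zero_one, Bar.d_zero_tprod, Bar.tmul_smul_zero, Bar.tmul_smul_zero]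
    simp
  | succ n ih =>
    -- On a word, `b' (-s φ d) = -φ d + s b' φ d`, and the last term is `-s φ d d = 0` by induction.
    refine eq_on_BDeg (f := Bar.d k (AAlg k σ) (n + 1) ∘ₗ comparison hσ (n + 2))
      (g := -(comparison hσ (n + 1) ∘ₗ dB k σ)) (fun l hl => ?_) hb
    have hmem : dB k σ (eWord k σ l) ∈ BDeg k σ (n + 1) :=
      dB_mem k σ (n + 1) _ (hl ▸ eWord_mem l)
    have hdd : dB k σ (dB k σ (eWord k σ l)) = 0 := dLin_dLin _
    have hval : comparison hσ (n + 2) (eWord k σ l) =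
        -Bar.homotopy (n + 1) (comparison hσ (n + 1) (dB k σ (eWord k σ l))) := by
      rw [comparison, freeLift_eWord]
    change Bar.d k (AAlg k σ) (n + 1) (comparison hσ (n + 2) (eWord k σ l)) =
      -comparison hσ (n + 1) (dB k σ (eWord k σ l))
    rw [hval, map_neg, Bar.d_homotopy, ih hmem, hdd, map_zero, neg_zero, map_zero, sub_zero]

/-- The comparison map `B_n → A ⊗ A^{⊗ n} ⊗ A`. -/
def comparisonPiece (hσ : IsSolution σ) (n : ℕ) :
    BPiece k σ n →ₗ[Env k (AAlg k σ)] Bar k (AAlg k σ) n :=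
  comparison hσ n ∘ₗ BPiece.val k σ n

theorem comparisonPiece_anti (hσ : IsSolution σ) :
    IsAntiChainMap (C := BPiece k σ) (D := Bar k (AAlg k σ)) (BPiece.d k σ)
      (Bar.d k (AAlg k σ)) (comparisonPiece hσ) :=
  fun n => LinearMap.ext fun b => d_comparison hσ n b.2

theorem comparisonPiece_one (hσ : IsSolution σ) :
    comparisonPiece hσ 0 (BPiece.one k σ) = Bar.tprod k (AAlg k σ) ![1, 1] :=
  comparison_zero_one hσ

theorem comparisonPiece_e (hσ : IsSolution σ) (x : X) :
    comparisonPiece hσ 1 (BPiece.e k σ x) = Bar.tprod k (AAlg k σ) ![1, AAlg.x k σ x, 1] :=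
  comparison_one_e hσ x

theorem comparisonPiece_zero_bijective (hσ : IsSolution σ) :
    Function.Bijective (comparisonPiece (k := k) hσ 0) := by
  refine Function.bijective_iff_has_inverse.2
    ⟨Bar.liftZero (BPiece.one k σ), fun b => Subtype.ext ?_, fun w => ?_⟩
  · refine eq_on_BDeg
      (f := BPiece.val k σ 0 ∘ₗ Bar.liftZero (BPiece.one k σ) ∘ₗ comparison hσ 0)
      (g := LinearMap.id) (fun l hl => ?_) b.2
    obtain rfl := List.length_eq_zero_iff.1 hl
    rw [eWord_nil]
    change BPiece.val k σ 0 (Bar.liftZero (BPiece.one k σ) (comparison hσ 0 1)) = 1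
    rw [comparison_zero_one, Bar.liftZero_tprod]
    simp only [Matrix.cons_val_zero, Matrix.cons_val_one, Env.tmul_one_one, one_smul]
    rfl
  · have h : (comparisonPiece hσ 0 ∘ₗ Bar.liftZero (BPiece.one k σ)).restrictScalars k =
        LinearMap.id := by
      refine Bar.hom_ext fun v => ?_
      change comparisonPiece hσ 0 (Bar.liftZero (BPiece.one k σ) (Bar.tprod k _ v)) =
        Bar.tprod k _ v
      rw [Bar.liftZero_tprod, LinearMap.map_smul, comparisonPiece_one, Bar.tmul_smul_zero]
      congr 1
      funext i
      fin_cases i <;> simp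
    exact LinearMap.congr_fun h w

/-- The word `e_x e_y` as an element of `B_2`. -/
def BPiece.ee (x y : X) : BPiece k σ 2 := ⟨eWord k σ [x, y], eWord_mem [x, y]⟩

/-- The boundary of `e_x e_y` is minus the derivative of the relation `x y = z t`. -/
theorem BPiece.d_ee (x y : X) :
    BPiece.d k σ 1 (BPiece.ee x y) =
      (Env.tmul k (AAlg.x k σ (σ (x, y)).1) 1 • BPiece.e k σ (σ (x, y)).2 +
        Env.tmul k 1 (AAlg.x k σ (σ (x, y)).2) • BPiece.e k σ (σ (x, y)).1) -
      (Env.tmul k (AAlg.x k σ x) 1 • BPiece.e k σ y +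
        Env.tmul k 1 (AAlg.x k σ y) • BPiece.e k σ x) := by
  have hinj : Function.Injective (BPiece.val k σ 1) := fun _ _ h => Subtype.ext h
  apply hinj
  have he : ∀ x, BPiece.val k σ 1 (BPiece.e k σ x) = BAlg.gen k σ (.e x) := fun _ => rfl
  have hee : BPiece.val k σ 2 (BPiece.ee x y) = BAlg.gen k σ (.e x) * BAlg.gen k σ (.e y) := by
    rw [← eWord_singleton y, ← eWord_cons]
    rfl
  have h := BAlg.gen_compat k σ
  rw [BPiece.val_d, hee]
  simp only [map_sub, map_add, LinearMap.map_smul, he, BAlg.tmul_smul, map_one, mul_one, one_mul,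
    incl_x, incl'_x]
  change dLin k σ _ = _
  rw [dLin_mul, dLin_gen, dLin_gen, sign_gen]
  simp only [dGen, Gen.deg, pow_one, neg_mul, one_mul, sub_mul, mul_sub, h.xe x y, h.ex' x y]
  abel

/-- Every element of `A ⊗ A ⊗ A` is, up to boundaries, in the image of `B_1`: modulo boundaries
`a ↦ 1 ⊗ a ⊗ 1` is a derivation, so it is determined by the generators of `A`. -/
theorem exists_eq_comparisonPiece_add_d (hσ : IsSolution σ) (w : Bar k (AAlg k σ) 1) :
    ∃ b v, w = comparisonPiece hσ 1 b + Bar.d k (AAlg k σ) 1 v := by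
  -- The sub-bimodule of the elements that have the required form.
  let S := LinearMap.range (comparisonPiece (k := k) hσ 1) ⊔
    LinearMap.range (Bar.d k (AAlg k σ) 1)
  have hd : ∀ v, Bar.d k (AAlg k σ) 1 v ∈ S := fun v => Submodule.mem_sup_right ⟨v, rfl⟩
  have hlin : ∃ f : AAlg k σ →ₗ[k] Bar k (AAlg k σ) 1,
      ∀ a, f a = Bar.tprod k (AAlg k σ) ![1, a, 1] :=
    ⟨(PiTensorProduct.tprod k).toLinearMap ![1, 0, 1] 1, fun a => by
      refine congrArg (Bar.tprod k (AAlg k σ)) ?_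
      funext i
      fin_cases i <;> rfl⟩
  obtain ⟨f, hf⟩ := hlin
  have hone : f 1 ∈ S := by
    have h := hd (Bar.tprod k (AAlg k σ) ![1, 1, 1, 1])
    rw [Bar.d_one_tprod] at h
    simpa [hf] using h
  have hmid : ∀ a, f a ∈ S := by
    intro a
    induction a using AAlg.induction k σ with
    | scalar r =>
      rw [Algebra.algebraMap_eq_smul_one, f.map_smul]
      exact (S.restrictScalars k).smul_mem r hone
    | gen x =>
      rw [hf, ← comparisonPiece_e hσ]
      exact Submodule.mem_sup_left ⟨_, rfl⟩
    | add a b ha hb => rw [map_add]; exact add_mem ha hb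
    | mul a b ha hb =>
      have h := hd (Bar.tprod k (AAlg k σ) ![1, a, b, 1])
      rw [Bar.d_one_tprod] at h
      have h1 : Bar.tprod k (AAlg k σ) ![a, b, 1] = Env.tmul k a 1 • f b := by
        rw [hf, Bar.tmul_smul_one]; simp
      have h2 : Bar.tprod k (AAlg k σ) ![1, a, b] = Env.tmul k 1 b • f a := by
        rw [hf, Bar.tmul_smul_one]; simp
      have h3 : f (a * b) = (Env.tmul k a 1 • f b + Env.tmul k 1 b • f a) -
          (Bar.tprod k (AAlg k σ) ![a, b, 1] - f (a * b) +
            Bar.tprod k (AAlg k σ) ![1, a, b]) := by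
        rw [h1, h2]; abel
      rw [h3]
      refine sub_mem (add_mem (S.smul_mem _ hb) (S.smul_mem _ ha)) ?_
      rw [hf (a * b)]
      simpa using h
  have hall : w ∈ S := by
    induction w using PiTensorProduct.induction_on with
    | add x y hx hy => exact add_mem hx hy
    | smul_tprod r v =>
      refine (S.restrictScalars k).smul_mem r ?_
      have h : PiTensorProduct.tprod k v = Env.tmul k (v 0) (v 2) • f (v 1) := by
        rw [hf, Bar.tmul_smul_one]
        refine congrArg (Bar.tprod k (AAlg k σ)) ?_
        funext i
        fin_cases i <;> simp
      rw [h]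
      exact S.smul_mem _ (hmid _)
  obtain ⟨_, ⟨b, rfl⟩, _, ⟨v, rfl⟩, h⟩ := Submodule.mem_sup.1 hall
  exact ⟨b, v, h.symm⟩

theorem exists_isLowDegreeIso_comparisonPiece (hσ : IsSolution σ) :
    ∃ θ, IsLowDegreeIso (C := BPiece k σ) (D := Bar k (AAlg k σ)) (BPiece.d k σ)
      (Bar.d k (AAlg k σ)) (comparisonPiece hσ) θ := by
  let Q := BPiece k σ 1 ⧸ LinearMap.range (BPiece.d k σ 1)
  let q : BPiece k σ 1 →ₗ[Env k (AAlg k σ)] Q := (LinearMap.range (BPiece.d k σ 1)).mkQ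
  obtain ⟨D, hDx, hD⟩ := exists_derivation (k := k) (σ := σ) (fun x => q (BPiece.e k σ x)) <| by
    intro x y
    simp only [← LinearMap.map_smul, ← map_add]
    exact ((Submodule.Quotient.eq (LinearMap.range (BPiece.d k σ 1))).2
      ⟨BPiece.ee x y, BPiece.d_ee x y⟩).symm
  refine ⟨Bar.liftOne D, comparisonPiece_anti hσ, Bar.d_zero_comp_d_one,
    comparisonPiece_zero_bijective hσ, Bar.liftOne_comp_d hD, ?_,
    exists_eq_comparisonPiece_add_d hσ⟩
  refine BPiece.hom_ext fun b l hl hb => ?_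
  obtain ⟨x, rfl⟩ := List.length_eq_one_iff.1 hl
  obtain rfl : b = BPiece.e k σ x := Subtype.ext (hb.trans (eWord_singleton x))
  change Bar.liftOne D (comparisonPiece hσ 1 (BPiece.e k σ x)) = q (BPiece.e k σ x)
  rw [comparisonPiece_e, Bar.liftOne_tprod]
  simp [Env.tmul_one_one, hDx]

end ComparisonMap

end

end YangBaxter

open YangBaxter
theorem mainTheorem9 {k : Type u} [CommRing k] {X : Type v} (σ : X × X ≃ X × X)
    (hσ : IsSolution σ) :
    ∃ φ : ∀ n : ℕ, BPiece k σ n →ₗ[Env k (AAlg k σ)] Bar k (AAlg k σ) n,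
      φ 0 (BPiece.one k σ) = Bar.tprod k (AAlg k σ) ![1, 1] ∧
      (∀ x : X, φ 1 (BPiece.e k σ x) = Bar.tprod k (AAlg k σ) ![1, AAlg.x k σ x, 1]) ∧
      (∀ (n : ℕ) (b : BPiece k σ (n + 1)),
        Bar.d k (AAlg k σ) n (φ (n + 1) b) = - φ n (BPiece.d k σ n b)) ∧
      (∃ F : ∀ (M : Type w) [AddCommGroup M] [Module k M] [Module (Env k (AAlg k σ)) M]
            [IsScalarTower k (Env k (AAlg k σ)) M] (n : ℕ), HYB k σ M n →ₗ[k] HH k σ M n,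
        (∀ (M : Type w) [AddCommGroup M] [Module k M] [Module (Env k (AAlg k σ)) M]
            [IsScalarTower k (Env k (AAlg k σ)) M],
          (∀ n : ℕ, InducesHomology (C := BPiece k σ) (D := Bar k (AAlg k σ)) (φ n) (F M n)) ∧
          Function.Bijective (F M 0) ∧ Function.Bijective (F M 1)) ∧
        (∀ (M M' : Type w) [AddCommGroup M] [Module k M] [Module (Env k (AAlg k σ)) M]
            [IsScalarTower k (Env k (AAlg k σ)) M] [AddCommGroup M'] [Module k M']
            [Module (Env k (AAlg k σ)) M'] [IsScalarTower k (Env k (AAlg k σ)) M']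
            (f : M →ₗ[Env k (AAlg k σ)] M') (n : ℕ) (h : HYB k σ M n),
          F M' n (HYB.map k σ f n h) = HH.map k σ f n (F M n h))) ∧
      (∃ G : ∀ (M : Type w) [AddCommGroup M] [Module k M] [Module (Env k (AAlg k σ)) M]
            [IsScalarTower k (Env k (AAlg k σ)) M] (n : ℕ), HHco k σ M n →ₗ[k] HYBco k σ M n,
        (∀ (M : Type w) [AddCommGroup M] [Module k M] [Module (Env k (AAlg k σ)) M]
            [IsScalarTower k (Env k (AAlg k σ)) M],
          (∀ n : ℕ, InducesCohomology (C := BPiece k σ) (D := Bar k (AAlg k σ)) (φ n) (G M n)) ∧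
          Function.Bijective (G M 0) ∧ Function.Bijective (G M 1)) ∧
        (∀ (M M' : Type w) [AddCommGroup M] [Module k M] [Module (Env k (AAlg k σ)) M]
            [IsScalarTower k (Env k (AAlg k σ)) M] [AddCommGroup M'] [Module k M']
            [Module (Env k (AAlg k σ)) M'] [IsScalarTower k (Env k (AAlg k σ)) M']
            (f : M →ₗ[Env k (AAlg k σ)] M') (n : ℕ) (h : HHco k σ M n),
          G M' n (HHco.map k σ f n h) = HYBco.map k σ f n (G M n h))) := by
  obtain ⟨θ, h⟩ := exists_isLowDegreeIso_comparisonPiece (k := k) hσ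
  refine ⟨comparisonPiece hσ, comparisonPiece_one hσ, comparisonPiece_e hσ,
    fun n b => LinearMap.congr_fun (comparisonPiece_anti hσ n) b,
    ⟨fun M _ _ _ _ n => h.anti.homologyMap M n, fun M _ _ _ _ => ⟨?_, ?_, ?_⟩, ?_⟩,
    ⟨fun M _ _ _ _ n => h.anti.cohomologyMap M n, fun M _ _ _ _ => ⟨?_, ?_, ?_⟩, ?_⟩⟩
  · exact h.anti.inducesHomology M
  · exact h.homologyMap_zero_bijective M
  · exact h.homologyMap_one_bijective M
  · intro M M' _ _ _ _ _ _ _ _ f n z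
    exact h.anti.homologyMap_natural f n z
  · exact h.anti.inducesCohomology M
  · exact h.cohomologyMap_zero_bijective M
  · exact h.cohomologyMap_one_bijective M
  · intro M M' _ _ _ _ _ _ _ _ f n z
    exact h.anti.cohomologyMap_natural f n z
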